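/- **Theorem 2.** Let $M\ge 2$ and let $g,h_1',\dots,h_M'$ be independent circularly symmetric complex Gaussian channel gains with zero mean and unit variance ($g$ of the grant-based user, $h_k'$ of the $M$ grant-free users); write $|h_1|^2\le\dots\le|h_M|^2$ for the values $|h_k'|^2$ in increasing order. Let $R_s,R_0>0$ be target rates, $P_s,P_0>0$ transmit powers, $\epsilon_s=2^{R_s}-1$, $\epsilon_0=2^{R_0}-1$, $\alpha_0=\epsilon_0/P_0$ and $\tau=\max\{0,P_0|g|^2/\epsilon_0-1\}$. Put $R_{k,I}=\log_2(1+P_s|h_k|^2)$ and $R_{k,II}=\log_2\bigl(1+\frac{P_s|h_k|^2}{P_0|g|^2+1}\bigr)$. User $k$ has the achievable rate $R_{k,I}$ if $P_s|h_k|^2<\tau$ and $R_{k,II}$ otherwise; a user with the largest achievable rate is admitted, and ${\rm P}_{out}$ is the probability that the rate of the admitted user is smaller than $R_s$. For $0\le m\le M$ let $E_m$ be the event that $|h_m|^2<\tau/P_s$ (if $m\ge1$) and $|h_{m+1}|^2>\tau/P_s$ (if $m<M$), and let $$Q_0={\rm P}(E_0,\,|g|^2>\alpha_0,\,R_{M,II}<R_s),\qquad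 Q_m={\rm P}(E_m,\,|g|^2>\alpha_0,\,\max\{R_{m,I},R_{M,II}\}<R_s)\ (1\le m\le M),\qquad Q_{M+1}={\rm P}(R_{M,II}<R_s,\,|g|^2<\alpha_0).$$ Assume $\epsilon_s\epsilon_0<1$, and put $\tilde\alpha_2=\frac{1+\epsilon_s}{1-\epsilon_0\epsilon_s}$, $\bar\eta_m=\frac{M!}{m!(M-m)!}$, $\tilde\eta_0=\frac{M!}{(M-2)!}$. Then ${\rm P}_{out}=\sum_{m=0}^{M+1}Q_m$ for all $P_s,P_0>0$, and for $P_s=P_0\to\infty$ $${\rm P}_{out}\sim A:=\sum_{m=1}^{M-2}A_m+A_{M-1}+A_0+A_M+A_{M+1},\qquad {\rm P}_{out}-A=O\bigl(P_s^{-(M+1)}\bigr)$$ (so the relative error of the approximation $A$ is $O(1/P_s)$), where, for $1\le m\le M-2$, $$\begin{aligned}A_m={}&\frac{\bar\eta_m}{P_s^{M+1}}\epsilon_s^m\sum_{i=0}^{M-m}\binom{M-m}{i}(\epsilon_s+1)^{M-m-i}(\epsilon_s-\epsilon_0^{-1})^i\epsilon_0^{i+1}\frac{\tilde\alpha_2^{i+1}-(1+\epsilon_s)^{i+1}}{i+1}\\&+\frac{\bar\eta_m}{P_s^{M+1}}\sum_{i=0}^{M-m}\binom{M-m}{i}(\epsilon_s+\epsilon_0\epsilon_s)^{M-m-i}(\epsilon_s-\epsilon_0^{-1})^i\epsilon_0^{i+1}\frac{\epsilon_s^{m+i+1}}{m+i+1},\end{aligned}$$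 $$A_{M-1}=\frac{\tilde\eta_0(1+\epsilon_s)\epsilon_s^{M-1}\epsilon_0}{P_s^{M+1}(M-1)}\Bigl((\tilde\alpha_2-1-\epsilon_s)+\frac{\epsilon_s}{M}\Bigr),$$ $$A_0=\frac{\tilde\eta_0}{P_s^{M+1}M(M-1)}e^{M/P_s}\sum_{i=0}^{M}\binom Mi(\epsilon_s+1)^{M-i}(\epsilon_s-\epsilon_0^{-1})^i\epsilon_0^{i+1}\frac{\tilde\alpha_2^{i+1}-1}{i+1},$$ $$A_M=\frac{\epsilon_0^{M+1}\epsilon_s^{M+1}}{P_s^{M+1}(M+1)\epsilon_0^M}+\frac{\epsilon_s^M}{P_s^M},\qquad A_{M+1}=\frac{\epsilon_s^M\bigl((1+\epsilon_0)^{M+1}-1\bigr)}{P_s^{M+1}(M+1)}.$$ Apart from the single term $\epsilon_s^M/P_s^M$ in $A_M$, each term $A_m$ ($0\le m\le M+1$, $m\neq M$), and also $A_M-\epsilon_s^M/P_s^M$, is of exact order $P_s^{-(M+1)}$. Moreover $Q_m\sim A_m$ for every $0\le m\le M+1$ with $m\ne M-1$, while $Q_{M-1}$ and $A_{M-1}$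 have the same exact order $P_s^{-(M+1)}$ and $Q_{M-1}\le A_{M-1}$ for all $P_s=P_0>0$. -/

import Mathlib

open MeasureTheory ProbabilityTheory Filter Asymptotics

namespace SGF

/-! ### Channel model -/

/-- The circularly symmetric complex Gaussian law with zero mean and unit variance: independent real
and imaginary parts, each real Gaussian with mean `0` and variance `1/2`. -/
noncomputable def stdComplexGaussian : Measure ℂ :=
  ((gaussianReal 0 (1 / 2 : NNReal)).prod (gaussianReal 0 (1 / 2 : NNReal))).map
    Complex.measurableEquivRealProd.symm

/-- The `m`-th smallest (`1 ≤ m ≤ M`) of the numbers `x 0, …, x (M - 1)`; the value is irrelevant for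
other `m`. -/
noncomputable def orderStat {M : ℕ} (x : Fin M → ℝ) (m : ℕ) : ℝ :=
  if hm : 1 ≤ m ∧ m ≤ M then x (Tuple.sort x ⟨m - 1, by omega⟩) else 0

/-! ### The transmission scheme, for a squared channel gain `y = |g|²` of the grant-based user -/

/-- `ε = 2 ^ R - 1` for a target rate `R`. -/
noncomputable def eps (R : ℝ) : ℝ := (2 : ℝ) ^ R - 1

/-- The threshold `τ(y)` broadcast by the base station. -/
noncomputable def tau (R₀ P₀ y : ℝ) : ℝ := max 0 (P₀ * y / ((2 : ℝ) ^ R₀ - 1) - 1)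

/-- Rate of a grant-free user with squared gain `x` that is decoded in the second stage. -/
noncomputable def rateI (Ps x : ℝ) : ℝ := Real.logb 2 (1 + Ps * x)

/-- Rate of a grant-free user with squared gain `x` that is decoded in the first stage. -/
noncomputable def rateII (Ps P₀ y x : ℝ) : ℝ := Real.logb 2 (1 + Ps * x / (P₀ * y + 1))

/-- The achievable rate of a grant-free user with squared gain `x`: users below the threshold
(Group 2) use `rateI`, the other ones (Group 1) use `rateII`. -/
noncomputable def userRate (R₀ Ps P₀ y x : ℝ) : ℝ :=
  if Ps * x < tau R₀ P₀ y then rateI Ps x else rateII Ps P₀ y x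

/-- The rate of the admitted user: the contention selects a user with the largest achievable
rate. -/
noncomputable def admittedRate {M : ℕ} (R₀ Ps P₀ y : ℝ) (x : Fin M → ℝ) : ℝ :=
  ⨆ k : Fin M, userRate R₀ Ps P₀ y (x k)

/-- The condition `E_m` (`0 ≤ m ≤ M`): exactly the `m` weakest users are in Group 2. -/
def groupCond {M : ℕ} (R₀ Ps P₀ y : ℝ) (x : Fin M → ℝ) (m : ℕ) : Prop :=
  (1 ≤ m → orderStat x m < tau R₀ P₀ y / Ps) ∧
    (m < M → tau R₀ P₀ y / Ps < orderStat x (m + 1))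

section Prob

variable {Ω : Type*} [MeasurableSpace Ω]

/-- Squared modulus of the channel gain of the grant-based user. -/
noncomputable def gainSq (g : Ω → ℂ) (ω : Ω) : ℝ := ‖g ω‖ ^ 2

/-- Squared moduli of the channel gains of the (not yet ordered) grant-free users. -/
noncomputable def gainsSq {M : ℕ} (h : Fin M → Ω → ℂ) (ω : Ω) : Fin M → ℝ :=
  fun k => ‖h k ω‖ ^ 2

/-- The outage probability: the rate of the admitted user is below the target rate `Rs`. -/
noncomputable def Pout {M : ℕ} (μ : Measure Ω) (g : Ω → ℂ) (h : Fin M → Ω → ℂ)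
    (Rs R₀ Ps P₀ : ℝ) : ℝ :=
  μ.real {ω | admittedRate R₀ Ps P₀ (gainSq g ω) (gainsSq h ω) < Rs}

/-- The probabilities `Q_m`, `0 ≤ m ≤ M + 1`: for `m ≤ M` it is the probability that `E_m` holds,
`|g|² > ε₀ / P₀`, and both the strongest user of Group 2 (if `m ≥ 1`) and user `M`, treated as a
user of Group 1, have a rate below `Rs`; for `m = M + 1` it is the probability that
`|g|² < ε₀ / P₀` and that user `M` has a rate below `Rs`. -/
noncomputable def Q {M : ℕ} (μ : Measure Ω) (g : Ω → ℂ) (h : Fin M → Ω → ℂ)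
    (Rs R₀ Ps P₀ : ℝ) (m : ℕ) : ℝ :=
  if m ≤ M then
    μ.real {ω | groupCond R₀ Ps P₀ (gainSq g ω) (gainsSq h ω) m ∧
      eps R₀ / P₀ < gainSq g ω ∧
      (1 ≤ m → rateI Ps (orderStat (gainsSq h ω) m) < Rs) ∧
      rateII Ps P₀ (gainSq g ω) (orderStat (gainsSq h ω) M) < Rs}
  else
    μ.real {ω | rateII Ps P₀ (gainSq g ω) (orderStat (gainsSq h ω) M) < Rs ∧
      gainSq g ω < eps R₀ / P₀}

end Prob

/-! ### The high-SNR expression, for `Ps = P₀ = P`; `s` is `ε_s` and `z` is `ε_0` -/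

/-- `α̃₂ = (1 + ε_s) / (1 - ε_0 ε_s)`. -/
noncomputable def alphaTwo (s z : ℝ) : ℝ := (1 + s) / (1 - z * s)

/-- `η̄_m = M! / (m! (M - m)!)`. -/
noncomputable def etaBar (M m : ℕ) : ℝ :=
  (M.factorial : ℝ) / ((m.factorial : ℝ) * ((M - m).factorial : ℝ))

/-- `η̃_0 = M! / (M - 2)!`. -/
noncomputable def etaTilde (M : ℕ) : ℝ := (M.factorial : ℝ) / ((M - 2).factorial : ℝ)

/-- The terms for `Q_m`, `1 ≤ m ≤ M - 2`. -/
noncomputable def approxMid (M : ℕ) (s z P : ℝ) (m : ℕ) : ℝ :=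
  etaBar M m / P ^ (M + 1) * s ^ m *
      ∑ i ∈ Finset.range (M - m + 1), ((M - m).choose i : ℝ) * (s + 1) ^ (M - m - i) *
        (s - z⁻¹) ^ i * z ^ (i + 1) *
          ((alphaTwo s z ^ (i + 1) - (1 + s) ^ (i + 1)) / ((i : ℝ) + 1)) +
    etaBar M m / P ^ (M + 1) *
      ∑ i ∈ Finset.range (M - m + 1), ((M - m).choose i : ℝ) * (s + z * s) ^ (M - m - i) *
        (s - z⁻¹) ^ i * z ^ (i + 1) * (s ^ (m + i + 1) / ((m : ℝ) + (i : ℝ) + 1))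

/-- The term for `Q_{M-1}`. -/
noncomputable def approxPenult (M : ℕ) (s z P : ℝ) : ℝ :=
  etaTilde M * (1 + s) * s ^ (M - 1) * z / (P ^ (M + 1) * ((M : ℝ) - 1)) *
    ((alphaTwo s z - 1 - s) + s / (M : ℝ))

/-- The term for `Q_0`. -/
noncomputable def approxZero (M : ℕ) (s z P : ℝ) : ℝ :=
  etaTilde M / (P ^ (M + 1) * (M : ℝ) * ((M : ℝ) - 1)) * Real.exp ((M : ℝ) / P) *
    ∑ i ∈ Finset.range (M + 1), (M.choose i : ℝ) * (s + 1) ^ (M - i) * (s - z⁻¹) ^ i *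
      z ^ (i + 1) * ((alphaTwo s z ^ (i + 1) - 1) / ((i : ℝ) + 1))

/-- The terms for `Q_M`. -/
noncomputable def approxFull (M : ℕ) (s z P : ℝ) : ℝ :=
  1 / (P ^ (M + 1) * ((M : ℝ) + 1) * z ^ M) * z ^ (M + 1) * s ^ (M + 1) + s ^ M / P ^ M

/-- The term for `Q_{M+1}`. -/
noncomputable def approxLast (M : ℕ) (s z P : ℝ) : ℝ :=
  s ^ M * ((1 + z) ^ (M + 1) - 1) / (P ^ (M + 1) * ((M : ℝ) + 1))

/-- The high-SNR expression for the outage probability. -/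
noncomputable def approx (M : ℕ) (s z P : ℝ) : ℝ :=
  ∑ m ∈ Finset.Icc 1 (M - 2), approxMid M s z P m + approxPenult M s z P + approxZero M s z P +
    approxFull M s z P + approxLast M s z P

end SGF

/-!
Rescale all squared gains by the common transmit power: with `u k = P * |h k|²` and `v = P * |g|²`
the outage conditions no longer involve `P`, and the joint law of the independent exponential
variables `u k`, `v` has the density `exp (-(∑ u k + v) / P) / P ^ (M + 1)` on the positive orthant
(`SGF.map_sq_norm_stdComplexGaussian`, by polar coordinates, and `SGF.hasLaw_gainsSq_gainSq`). Here
`s` is `ε_s` and `z` is `ε_0`.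

Conditions on order statistics become conditions on unordered gains
(`SGF.orderStat_conditions_iff`): `Q_m` is the probability that some `m` of the users have
`u k < min τ s`, while the others have `τ < u k < s * (v + 1)`. The choices of the `m` users exclude
each other, so given `v` this has probability `M.choose m` times a product of probabilities of
intervals (`SGF.measureReal_groupEvent`). Off the null set of ties, exactly one of these events
happens if there is an outage and none otherwise, which makes the outage probability the sum of
the `Q_m` (`SGF.Pout_eq_sum_Q`).

For `m < M` the conditions `z < v` and `τ < s * (v + 1)` confine `v` to
`(z, z * alphaTwo s z)`; this is where `ε_s * ε_0 < 1` enters. The rescaled outage event is then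
bounded, the exponential factor in the density is between `exp (-K / P)` and `1` on it, and hence
`exp (-K / P) * V ≤ P ^ (M + 1) * Q_m ≤ V` with `V` the volume of that event
(`SGF.Q_bounds_of_lt`; `SGF.Q_last_bounds` for `Q_{M+1}`). The binomial theorem turns the integral
`V` into the sums of the approximation, except that for `m = M - 1` the approximation bounds a width
by `1 + s` instead (`SGF.limitVolume_penult_le`), so that only an upper bound of the right order
results. For `m = M` the event is not bounded: once `v > z * (1 + s)`, only the conditions `u k < s`
remain, which gives the leading term `(s / P) ^ M` up to an error of order `1 / P ^ (M + 1)`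
(`SGF.Q_full_bounds`).
-/

namespace SGF

open Set

/-! ### Laws of the squared channel gains -/

lemma lintegral_comp_sq_norm_stdComplexGaussian {f : ℝ → ENNReal} (hf : Measurable f) :
    ∫⁻ c, f (‖c‖ ^ 2) ∂stdComplexGaussian =
      ∫⁻ t in Ioi (0 : ℝ), ENNReal.ofReal (Real.exp (-t)) * f t := by
  have hv : (1 / 2 : NNReal) ≠ 0 := by norm_num
  have hG : ∀ a b : ℝ, gaussianPDF 0 (1 / 2) a * gaussianPDF 0 (1 / 2) b =
      ENNReal.ofReal (Real.pi⁻¹ * Real.exp (-(a ^ 2 + b ^ 2))) := by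
    intro a b
    rw [gaussianPDF, gaussianPDF, ← ENNReal.ofReal_mul (gaussianPDFReal_nonneg _ _ _),
      gaussianPDFReal, gaussianPDFReal, mul_mul_mul_comm, ← Real.exp_add, ← mul_inv,
      Real.mul_self_sqrt (by positivity)]
    congr 2
    · simp
      ring
    · congr 1
      push_cast
      ring
  have hsq : ∀ p : ℝ × ℝ, ‖Complex.measurableEquivRealProd.symm p‖ ^ 2 = p.1 ^ 2 + p.2 ^ 2 := by
    intro p
    rw [← Complex.normSq_eq_norm_sq, Complex.normSq_apply]
    simp [Complex.measurableEquivRealProd]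
    ring
  have himg : (fun r : ℝ => r ^ 2) '' Ioi 0 = Ioi 0 := by
    ext t
    constructor
    · rintro ⟨r, hr, rfl⟩
      exact pow_pos (mem_Ioi.1 hr) 2
    · intro ht
      exact ⟨√t, Real.sqrt_pos.2 ht, Real.sq_sqrt (le_of_lt ht)⟩
  have hchange := lintegral_image_eq_lintegral_abs_deriv_mul (s := Ioi (0 : ℝ))
    (f := fun r : ℝ => r ^ 2) (f' := fun r => 2 * r) measurableSet_Ioi
    (fun x _ => by simpa using (hasDerivAt_pow 2 x).hasDerivWithinAt)
    (fun a ha b hb hab => (pow_left_inj₀ (le_of_lt ha) (le_of_lt hb) two_ne_zero).1 hab)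
    (fun t => ENNReal.ofReal (Real.exp (-t)) * f t)
  rw [himg] at hchange
  rw [hchange, stdComplexGaussian, lintegral_map (by fun_prop) (by fun_prop),
    gaussianReal_of_var_ne_zero _ hv, prod_withDensity (measurable_gaussianPDF _ _)
    (measurable_gaussianPDF _ _), lintegral_withDensity_eq_lintegral_mul _ (by fun_prop)
    (by fun_prop)]
  simp only [Pi.mul_apply, hsq, hG]
  rw [← Measure.volume_eq_prod, ← lintegral_comp_polarCoord_symm]
  have hpol : ∀ p : ℝ × ℝ, (polarCoord.symm p).1 ^ 2 + (polarCoord.symm p).2 ^ 2 = p.1 ^ 2 := by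
    intro p
    simp only [polarCoord_symm_apply]
    nlinarith [Real.sin_sq_add_cos_sq p.2]
  simp only [hpol]
  rw [polarCoord_target, Measure.volume_eq_prod, ← Measure.prod_restrict]
  rw [lintegral_congr (g := fun p : ℝ × ℝ => (ENNReal.ofReal p.1 *
    (ENNReal.ofReal (Real.pi⁻¹ * Real.exp (-p.1 ^ 2)) * f (p.1 ^ 2))) *
      (fun _ : ℝ => (1 : ENNReal)) p.2)
    (fun p => by simp),
    lintegral_prod_mul (f := fun r : ℝ => ENNReal.ofReal r *
    (ENNReal.ofReal (Real.pi⁻¹ * Real.exp (-r ^ 2)) * f (r ^ 2))) (g := fun _ : ℝ => (1 : ENNReal))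
    (by fun_prop) (by fun_prop)]
  simp only [lintegral_const, one_mul, Measure.restrict_apply MeasurableSet.univ, univ_inter,
    Real.volume_Ioo]
  rw [← lintegral_mul_const _ (by fun_prop)]
  refine setLIntegral_congr_fun measurableSet_Ioi fun r hr => ?_
  have hr' : (0 : ℝ) < r := hr
  rw [abs_of_pos (by positivity), ← mul_assoc, ← mul_assoc, mul_right_comm,
    ← ENNReal.ofReal_mul hr'.le, ← ENNReal.ofReal_mul (by positivity),
    ← ENNReal.ofReal_mul (by positivity)]
  congr 2
  field_simp
  ring

lemma exponentialPDF_one_eq_indicator :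
    exponentialPDF 1 = (Ici (0 : ℝ)).indicator fun t => ENNReal.ofReal (Real.exp (-t)) := by
  ext t
  rw [exponentialPDF_eq]
  by_cases ht : 0 ≤ t <;> simp [ht]

lemma expMeasure_one_eq :
    expMeasure 1 = (volume.restrict (Ioi (0 : ℝ))).withDensity
      fun t => ENNReal.ofReal (Real.exp (-t)) := by
  rw [expMeasure, gammaMeasure, ← restrict_withDensity measurableSet_Ioi]
  change volume.withDensity (exponentialPDF 1) = _
  rw [exponentialPDF_one_eq_indicator, withDensity_indicator measurableSet_Ici,
    restrict_withDensity measurableSet_Ioi, Measure.restrict_congr_set Ioi_ae_eq_Ici.symm]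

/-- The squared modulus of a standard complex Gaussian variable is exponentially distributed. -/
lemma map_sq_norm_stdComplexGaussian :
    stdComplexGaussian.map (fun c => ‖c‖ ^ 2) = expMeasure 1 := by
  ext S hS
  rw [expMeasure_one_eq, withDensity_apply _ hS, ← lintegral_indicator_one hS,
    lintegral_map (measurable_one.indicator hS) (by fun_prop),
    lintegral_comp_sq_norm_stdComplexGaussian (measurable_one.indicator hS),
    ← lintegral_indicator hS]
  refine lintegral_congr fun t => ?_
  by_cases ht : t ∈ S <;> simp [ht]

instance isProbabilityMeasure_expMeasure_one : IsProbabilityMeasure (expMeasure 1) :=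
  isProbabilityMeasure_expMeasure one_pos

instance nullSingletonClass_expMeasure_one : NullSingletonClass (expMeasure 1) := by
  rw [expMeasure_one_eq]
  infer_instance

/-- The squared channel gains of all users are independent and exponentially distributed. -/
lemma hasLaw_gainsSq_gainSq {Ω : Type*} [MeasurableSpace Ω] {μ : Measure Ω} {M : ℕ}
    {g : Ω → ℂ} {h : Fin M → Ω → ℂ}
    (hg : HasLaw g stdComplexGaussian μ) (hh : ∀ k, HasLaw (h k) stdComplexGaussian μ)
    (hindep : iIndepFun (fun i : Option (Fin M) => i.elim g h) μ) :
    HasLaw (fun ω => (gainsSq h ω, gainSq g ω))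
      ((Measure.pi fun _ : Fin M => expMeasure 1).prod (expMeasure 1)) μ := by
  have hlaw : HasLaw (fun c : ℂ => ‖c‖ ^ 2) (expMeasure 1) stdComplexGaussian :=
    ⟨by fun_prop, map_sq_norm_stdComplexGaussian⟩
  have hind : iIndepFun (fun i : Option (Fin M) => (fun c : ℂ => ‖c‖ ^ 2) ∘ i.elim g h) μ :=
    hindep.comp (fun _ c => ‖c‖ ^ 2) fun _ => by fun_prop
  have hl : ∀ i : Option (Fin M),
      HasLaw ((fun c : ℂ => ‖c‖ ^ 2) ∘ i.elim g h) (expMeasure 1) μ := by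
    rintro (_ | k)
    · exact hlaw.comp hg
    · exact hlaw.comp (hh k)
  have hpi := hind.hasLaw_pi hl
  let e := MeasurableEquiv.piOptionEquivProd (fun _ : Option (Fin M) => ℝ)
  have he : HasLaw e ((Measure.pi fun _ : Fin M => expMeasure 1).prod (expMeasure 1))
      (Measure.pi fun _ : Option (Fin M) => expMeasure 1) := by
    refine ⟨e.measurable.aemeasurable, ?_⟩
    rw [← Measure.pi_map_piOptionEquivProd (fun _ : Option (Fin M) => expMeasure 1),
      MeasurableEquiv.map_map_symm]
  exact he.comp hpi

/-! ### Comparing the exponential law with Lebesgue measure -/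

lemma expMeasure_one_le_volume : expMeasure 1 ≤ volume := by
  rw [expMeasure_one_eq]
  refine le_trans (withDensity_mono (g := fun _ => 1) ?_) ?_
  · refine (ae_restrict_iff' measurableSet_Ioi).2 (ae_of_all _ fun t ht => ?_)
    simpa using le_of_lt ht
  · rw [withDensity_const, one_smul]
    exact Measure.restrict_le_self

lemma smul_volume_restrict_le_expMeasure_one {S : Set ℝ} {K : ℝ} (hS : MeasurableSet S)
    (hSK : S ⊆ Ioc 0 K) :
    ENNReal.ofReal (Real.exp (-K)) • volume.restrict S ≤ (expMeasure 1).restrict S := by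
  rw [expMeasure_one_eq, restrict_withDensity hS, Measure.restrict_restrict hS,
    inter_eq_left.2 (show S ⊆ Ioi 0 from fun t ht => (hSK ht).1), ← withDensity_const]
  refine withDensity_mono ((ae_restrict_iff' hS).2 (ae_of_all _ fun t ht => ?_))
  exact ENNReal.ofReal_le_ofReal (Real.exp_le_exp.2 (neg_le_neg (hSK ht).2))

lemma expMeasure_one_real_Ioo_le {c b : ℝ} (hcb : c ≤ b) :
    (expMeasure 1).real (Ioo c b) ≤ b - c := by
  have h := ENNReal.toReal_mono (by simp) (expMeasure_one_le_volume (Ioo c b))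
  rwa [Real.volume_Ioo, ENNReal.toReal_ofReal (sub_nonneg.2 hcb)] at h

lemma le_expMeasure_one_real_Ioo {c b : ℝ} (hc : 0 ≤ c) (hcb : c ≤ b) :
    Real.exp (-b) * (b - c) ≤ (expMeasure 1).real (Ioo c b) := by
  have h := smul_volume_restrict_le_expMeasure_one (S := Ioo c b) (K := b) measurableSet_Ioo
    (fun t ht => ⟨hc.trans_lt ht.1, ht.2.le⟩) univ
  simp only [Measure.smul_apply, Measure.restrict_apply_univ, smul_eq_mul, Real.volume_Ioo] at h
  have h' := ENNReal.toReal_mono (measure_ne_top _ _) h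
  rwa [ENNReal.toReal_mul, ENNReal.toReal_ofReal (Real.exp_nonneg _),
    ENNReal.toReal_ofReal (sub_nonneg.2 hcb)] at h'

lemma expMeasure_one_Iic_zero : expMeasure 1 (Iic 0) = 0 := by
  rw [expMeasure_one_eq]
  refine withDensity_absolutelyContinuous _ _ ?_
  rw [Measure.restrict_apply measurableSet_Iic]
  rw [inter_comm, Ioi_inter_Iic, Ioc_self, measure_empty]

lemma expMeasure_one_real_Iio {a : ℝ} :
    (expMeasure 1).real (Iio a) = (expMeasure 1).real (Ioo 0 a) := by
  refine measureReal_congr ?_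
  have : ∀ᵐ t ∂(expMeasure 1), 0 < t := by
    rw [ae_iff]
    simpa [Iic] using expMeasure_one_Iic_zero
  filter_upwards [this] with t ht
  exact propext ⟨fun h => ⟨ht, h⟩, fun h => h.2⟩

lemma expMeasure_one_real_Iio_le {a : ℝ} (ha : 0 ≤ a) : (expMeasure 1).real (Iio a) ≤ a := by
  rw [expMeasure_one_real_Iio]
  simpa using expMeasure_one_real_Ioo_le ha

lemma le_expMeasure_one_real_Iio {a : ℝ} (ha : 0 ≤ a) :
    Real.exp (-a) * a ≤ (expMeasure 1).real (Iio a) := by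
  rw [expMeasure_one_real_Iio]
  simpa using le_expMeasure_one_real_Ioo le_rfl ha

lemma le_expMeasure_one_real_Ioi {a : ℝ} (ha : 0 ≤ a) :
    Real.exp (-a) ≤ (expMeasure 1).real (Ioi a) := by
  have h := cdf_expMeasure_eq one_pos a
  rw [if_pos ha, cdf_eq_real, one_mul] at h
  rw [← compl_Iic, probReal_compl_eq_one_sub measurableSet_Iic, h]
  simp

/-- Rescaling by `P` turns integrals over the exponential law into Lebesgue integrals, up to a
factor that tends to `1`: the density of the rescaled law is between `exp (-v₁ / P) / P`
and `1 / P`. -/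
lemma scaled_setIntegral_expMeasure_one_bounds {v₀ v₁ L P : ℝ} (hv₀ : 0 ≤ v₀) (hv : v₀ ≤ v₁)
    (hP : 0 < P) {N : ℕ} {F J : ℝ → ℝ} (hF : Measurable F) (hJ : Continuous J)
    (hJ0 : ∀ v ∈ Ioo v₀ v₁, 0 ≤ J v)
    (hlow : ∀ v ∈ Ioo v₀ v₁, Real.exp (-(L / P)) * J v ≤ P ^ N * F (v / P))
    (hupp : ∀ v ∈ Ioo v₀ v₁, P ^ N * F (v / P) ≤ J v) :
    Real.exp (-((v₁ + L) / P)) * ∫ v in v₀..v₁, J v ≤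
        P ^ (N + 1) * ∫ y in Ioo (v₀ / P) (v₁ / P), F y ∂expMeasure 1 ∧
      P ^ (N + 1) * ∫ y in Ioo (v₀ / P) (v₁ / P), F y ∂expMeasure 1 ≤ ∫ v in v₀..v₁, J v := by
  set I := Ioo (v₀ / P) (v₁ / P) with hI
  have hmem : ∀ y ∈ I, P * y ∈ Ioo v₀ v₁ := fun y hy =>
    ⟨(div_lt_iff₀' hP).1 hy.1, (lt_div_iff₀' hP).1 hy.2⟩
  have hdiv : ∀ y : ℝ, P * y / P = y := fun y => by field_simp
  have hlow' : ∀ y ∈ I, Real.exp (-(L / P)) * J (P * y) ≤ P ^ N * F y := fun y hy => by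
    simpa only [hdiv] using hlow _ (hmem y hy)
  have hupp' : ∀ y ∈ I, P ^ N * F y ≤ J (P * y) := fun y hy => by
    simpa only [hdiv] using hupp _ (hmem y hy)
  have hJ0' : ∀ y ∈ I, 0 ≤ J (P * y) := fun y hy => hJ0 _ (hmem y hy)
  have hmeasI : MeasurableSet I := measurableSet_Ioo
  have hle : (expMeasure 1).restrict I ≤ volume.restrict I :=
    Measure.restrict_mono le_rfl expMeasure_one_le_volume
  have hint : Integrable (fun y => J (P * y)) (volume.restrict I) :=
    ((by fun_prop : Continuous fun y => J (P * y)).integrableOn_Icc).mono_set Ioo_subset_Icc_self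
  have hint' : Integrable (fun y => J (P * y)) ((expMeasure 1).restrict I) := hint.mono_measure hle
  have hintF : Integrable (fun y => P ^ N * F y) ((expMeasure 1).restrict I) := by
    refine hint'.mono' (by fun_prop) ((ae_restrict_iff' hmeasI).2 (ae_of_all _ fun y hy => ?_))
    rw [Real.norm_of_nonneg (le_trans (mul_nonneg (Real.exp_nonneg _) (hJ0' y hy)) (hlow' y hy))]
    exact hupp' y hy
  have hsubst : P * ∫ y in I, J (P * y) = ∫ v in v₀..v₁, J v := by
    have h := intervalIntegral.integral_comp_mul_left (a := v₀ / P) (b := v₁ / P) J hP.ne'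
    rw [mul_div_cancel₀ _ hP.ne', mul_div_cancel₀ _ hP.ne',
      intervalIntegral.integral_of_le (by gcongr), integral_Ioc_eq_integral_Ioo, smul_eq_mul] at h
    rw [hI, h, mul_inv_cancel_left₀ hP.ne']
  have hpow : P ^ (N + 1) * ∫ y in I, F y ∂expMeasure 1 =
      P * ∫ y in I, P ^ N * F y ∂expMeasure 1 := by
    rw [integral_const_mul, pow_succ]
    ring
  rw [hpow, ← hsubst]
  constructor
  · have h1 := integral_mono_measure (smul_volume_restrict_le_expMeasure_one (S := I)
      (K := v₁ / P) hmeasI (fun y hy => ⟨(div_nonneg hv₀ hP.le).trans_lt hy.1, hy.2.le⟩))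
      ((ae_restrict_iff' hmeasI).2 (ae_of_all _ hJ0')) hint'
    rw [integral_smul_measure, ENNReal.toReal_ofReal (Real.exp_nonneg _), smul_eq_mul] at h1
    have h2 := setIntegral_mono_on (hint'.const_mul (Real.exp (-(L / P)))) hintF hmeasI hlow'
    rw [integral_const_mul] at h2
    have h3 : Real.exp (-((v₁ + L) / P)) = Real.exp (-(L / P)) * Real.exp (-(v₁ / P)) := by
      rw [← Real.exp_add]
      congr 1
      ring
    calc _ = P * (Real.exp (-(L / P)) * (Real.exp (-(v₁ / P)) * ∫ y in I, J (P * y))) := by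
          rw [h3]
          ring
      _ ≤ _ := by gcongr; exact (mul_le_mul_of_nonneg_left h1 (Real.exp_nonneg _)).trans h2
  · refine mul_le_mul_of_nonneg_left ?_ hP.le
    exact (setIntegral_mono_on hintF hint' hmeasI hupp').trans
      (integral_mono_measure hle ((ae_restrict_iff' hmeasI).2 (ae_of_all _ hJ0')) hint)

/-! ### Group events in the product space -/

/-- The event that the squared gain `y` of the grant-based user is in `A`, that some `m` of the
grant-free users have squared gains below `a y`, and that those of all the others are strictly
between `c y` and `b y`. Points of the product space are pairs of the (unordered) grant-free gains
and the grant-based one. -/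
def groupEvent {M : ℕ} (A : Set ℝ) (a c b : ℝ → ℝ) (m : ℕ) : Set ((Fin M → ℝ) × ℝ) :=
  {p | p.2 ∈ A ∧ ∃ S : Finset (Fin M), S.card = m ∧ (∀ k ∈ S, p.1 k < a p.2) ∧
    ∀ k ∉ S, c p.2 < p.1 k ∧ p.1 k < b p.2}

lemma measurableSet_groupEvent {M m : ℕ} {A : Set ℝ} {a c b : ℝ → ℝ} (hA : MeasurableSet A)
    (ha : Measurable a) (hc : Measurable c) (hb : Measurable b) :
    MeasurableSet (groupEvent (M := M) A a c b m) := by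
  have : groupEvent (M := M) A a c b m = Prod.snd ⁻¹' A ∩ ⋃ S : Finset (Fin M), ⋃ _ : S.card = m,
      (⋂ k ∈ S, {p : (Fin M → ℝ) × ℝ | p.1 k < a p.2}) ∩
        ⋂ k ∈ Sᶜ, {p : (Fin M → ℝ) × ℝ | c p.2 < p.1 k} ∩ {p | p.1 k < b p.2} := by
    ext p
    simp [groupEvent, and_left_comm]
  rw [this]
  refine (measurable_snd hA).inter (MeasurableSet.iUnion fun S => MeasurableSet.iUnion fun _ =>
    (Finset.measurableSet_biInter _ fun k _ => ?_).inter
      (Finset.measurableSet_biInter _ fun k _ => MeasurableSet.inter ?_ ?_))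
  all_goals exact measurableSet_lt (by fun_prop) (by fun_prop)

/-- The events for the different sets `S` of users below `a` are disjoint because `a ≤ c`. -/
lemma pi_expMeasure_one_exists_subset {M m : ℕ} {a c b : ℝ} (hac : a ≤ c) :
    (Measure.pi fun _ : Fin M => expMeasure 1) {x | ∃ S : Finset (Fin M), S.card = m ∧
      (∀ k ∈ S, x k < a) ∧ ∀ k ∉ S, c < x k ∧ x k < b} =
    M.choose m * (expMeasure 1 (Iio a) ^ m * expMeasure 1 (Ioo c b) ^ (M - m)) := by
  classical
  let B : Finset (Fin M) → Set (Fin M → ℝ) := fun S =>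
    univ.pi fun k => if k ∈ S then Iio a else Ioo c b
  have hB : ∀ S x, x ∈ B S ↔ (∀ k ∈ S, x k < a) ∧ ∀ k ∉ S, c < x k ∧ x k < b := by
    intro S x
    simp only [B, mem_univ_pi]
    refine ⟨fun h => ⟨fun k hk => by simpa [hk] using h k, fun k hk => by simpa [hk] using h k⟩,
      fun h k => ?_⟩
    by_cases hk : k ∈ S
    · simpa [hk] using h.1 k hk
    · simpa [hk] using h.2 k hk
  have hset : {x | ∃ S : Finset (Fin M), S.card = m ∧
      (∀ k ∈ S, x k < a) ∧ ∀ k ∉ S, c < x k ∧ x k < b} =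
      ⋃ S ∈ (Finset.univ : Finset (Fin M)).powersetCard m, B S := by
    ext x
    simp [hB, and_left_comm]
  have hmeas : ∀ S ∈ (Finset.univ : Finset (Fin M)).powersetCard m,
      (Measure.pi fun _ : Fin M => expMeasure 1) (B S) =
        expMeasure 1 (Iio a) ^ m * expMeasure 1 (Ioo c b) ^ (M - m) := by
    intro S hS
    have hS' := (Finset.mem_powersetCard.1 hS).2
    rw [Measure.pi_pi]
    simp only [apply_ite (expMeasure 1), Finset.prod_ite, Finset.prod_const]
    have h1 : (Finset.univ.filter fun k => k ∈ S) = S := by simp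
    have h2 : (Finset.univ.filter fun k => k ∉ S) = Sᶜ := by ext; simp
    rw [h1, h2, Finset.card_compl, hS', Fintype.card_fin]
  rw [hset, measure_biUnion_finset, Finset.sum_congr rfl hmeas, Finset.sum_const,
    Finset.card_powersetCard, Finset.card_univ, Fintype.card_fin, nsmul_eq_mul]
  · intro S hS T hT hST
    rw [Function.onFun, Set.disjoint_left]
    intro x hxS hxT
    rw [hB] at hxS hxT
    refine hST (Finset.eq_of_subset_of_card_le (fun k hk => ?_) ?_)
    · by_contra hkT
      exact absurd ((hxS.1 k hk).trans_le (hac.trans (hxT.2 k hkT).1.le)) (lt_irrefl _)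
    · rw [(Finset.mem_powersetCard.1 (Finset.mem_coe.1 hS)).2,
        (Finset.mem_powersetCard.1 (Finset.mem_coe.1 hT)).2]
  · intro S _
    exact MeasurableSet.univ_pi fun k => by split_ifs <;> measurability

lemma measureReal_groupEvent {M m : ℕ} {A : Set ℝ} {a c b : ℝ → ℝ}
    (hA : MeasurableSet A) (ha : Measurable a) (hc : Measurable c) (hb : Measurable b)
    (hac : ∀ y ∈ A, a y ≤ c y) :
    ((Measure.pi fun _ : Fin M => expMeasure 1).prod (expMeasure 1)).real (groupEvent A a c b m) =
      M.choose m * ∫ y in A, (expMeasure 1).real (Iio (a y)) ^ m *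
        (expMeasure 1).real (Ioo (c y) (b y)) ^ (M - m) ∂expMeasure 1 := by
  have hmeas := measurableSet_groupEvent (M := M) (m := m) hA ha hc hb
  have hsec : ∀ y, (Measure.pi fun _ : Fin M => expMeasure 1)
      ((fun x => (x, y)) ⁻¹' groupEvent A a c b m) =
      A.indicator (fun y => (M.choose m : ENNReal) * (expMeasure 1 (Iio (a y)) ^ m *
        expMeasure 1 (Ioo (c y) (b y)) ^ (M - m))) y := by
    intro y
    by_cases hy : y ∈ A
    · rw [indicator_of_mem hy, ← pi_expMeasure_one_exists_subset (hac y hy)]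
      congr 1
      ext x
      simp [groupEvent, hy]
    · rw [indicator_of_notMem hy]
      simp [groupEvent, hy]
  have hm1 := measurable_measure_prodMk_right (μ := Measure.pi fun _ : Fin M => expMeasure 1) hmeas
  rw [measureReal_def, Measure.prod_apply_symm hmeas, ← integral_toReal hm1.aemeasurable
    (ae_of_all _ fun y => measure_lt_top _ _), ← integral_const_mul, ← integral_indicator hA]
  refine integral_congr_ae (ae_of_all _ fun y => ?_)
  simp only [hsec]
  by_cases hy : y ∈ A
  · simp [hy, measureReal_def]
  · simp [hy]

lemma measurable_expMeasure_one_real_Iio {a : ℝ → ℝ} (ha : Measurable a) :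
    Measurable fun y => (expMeasure 1).real (Iio (a y)) :=
  (measurable_measure_prodMk_left (ν := expMeasure 1)
    (measurableSet_lt measurable_snd (ha.comp measurable_fst))).ennreal_toReal

lemma measurable_expMeasure_one_real_Ioo {c b : ℝ → ℝ} (hc : Measurable c) (hb : Measurable b) :
    Measurable fun y => (expMeasure 1).real (Ioo (c y) (b y)) :=
  (measurable_measure_prodMk_left (ν := expMeasure 1)
    ((measurableSet_lt (hc.comp measurable_fst) measurable_snd).inter
      (measurableSet_lt measurable_snd (hb.comp measurable_fst)))).ennreal_toReal

/-! ### Order statistics -/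

lemma orderStat_eq {M : ℕ} (x : Fin M → ℝ) {m : ℕ} (h₁ : 1 ≤ m) (h₂ : m ≤ M) :
    orderStat x m = x (Tuple.sort x ⟨m - 1, by omega⟩) := by
  rw [orderStat, dif_pos ⟨h₁, h₂⟩]

lemma orderStat_nonneg {M : ℕ} {x : Fin M → ℝ} (hx : ∀ k, 0 ≤ x k) (m : ℕ) :
    0 ≤ orderStat x m := by
  rw [orderStat]
  split_ifs
  · exact hx _
  · exact le_rfl

/-- The set of the first `m` indices in the ordering given by `σ`. -/
lemma exists_finset_perm_mem_iff {M m : ℕ} (hm : m ≤ M) (σ : Equiv.Perm (Fin M)) :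
    ∃ S : Finset (Fin M), S.card = m ∧ ∀ i, σ i ∈ S ↔ i.val < m := by
  refine ⟨Finset.univ.map ((Fin.castLEEmb hm).trans σ.toEmbedding), by simp, fun i => ?_⟩
  simp only [Finset.mem_map, Finset.mem_univ, true_and]
  constructor
  · rintro ⟨j, hj⟩
    have : Fin.castLE hm j = i := σ.injective hj
    rw [← this]
    exact j.2
  · intro hi
    exact ⟨⟨i, hi⟩, rfl⟩

/-- A condition on the order statistics, in terms of the set of the `m` smallest entries. -/
lemma orderStat_conditions_iff {M m : ℕ} (hM : 1 ≤ M) (hm : m ≤ M) (x : Fin M → ℝ)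
    {t u w : ℝ} (huw : u ≤ w) :
    (((1 ≤ m → orderStat x m < t) ∧ (m < M → t < orderStat x (m + 1))) ∧
      (1 ≤ m → orderStat x m < u) ∧ orderStat x M < w) ↔
    ∃ S : Finset (Fin M), S.card = m ∧ (∀ k ∈ S, x k < min t u) ∧
      ∀ k ∉ S, t < x k ∧ x k < w := by
  set σ := Tuple.sort x with hσ
  have hmono : ∀ i j : Fin M, i ≤ j → x (σ i) ≤ x (σ j) := Tuple.monotone_sort x
  have hlast : orderStat x M = x (σ ⟨M - 1, by omega⟩) := orderStat_eq x hM le_rfl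
  constructor
  · rintro ⟨⟨h1, h2⟩, h3, h4⟩
    obtain ⟨S, hS, hSσ⟩ := exists_finset_perm_mem_iff hm σ
    refine ⟨S, hS, fun k hk => ?_, fun k hk => ?_⟩
    · obtain ⟨i, rfl⟩ := σ.surjective k
      have hi := (hSσ i).1 hk
      have hm1 : 1 ≤ m := by omega
      have hle : x (σ i) ≤ orderStat x m := by
        rw [orderStat_eq x hm1 hm]
        exact hmono _ _ (Fin.mk_le_mk.2 (by omega) : i ≤ ⟨m - 1, by omega⟩)
      exact lt_min (hle.trans_lt (h1 hm1)) (hle.trans_lt (h3 hm1))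
    · obtain ⟨i, rfl⟩ := σ.surjective k
      have hi : m ≤ i.val := not_lt.1 fun h => hk ((hSσ i).2 h)
      have hi2 := i.2
      have hlow : orderStat x (m + 1) ≤ x (σ i) := by
        rw [orderStat_eq x (by omega) (by omega)]
        exact hmono _ _ (Fin.mk_le_mk.2 (by simpa using hi))
      have hupp : x (σ i) ≤ orderStat x M := by
        rw [hlast]
        exact hmono _ _ (Fin.mk_le_mk.2 (by omega) : i ≤ ⟨M - 1, by omega⟩)
      exact ⟨(h2 (by omega)).trans_le hlow, hupp.trans_lt h4⟩
  · rintro ⟨S, hS, hlt, hgt⟩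
    have key : 1 ≤ m → orderStat x m < min t u := by
      intro hm1
      by_contra hcon
      rw [not_lt, orderStat_eq x hm1 hm] at hcon
      obtain ⟨T, hT, hTσ⟩ := exists_finset_perm_mem_iff (show m - 1 ≤ M by omega) σ
      have hsub : S ⊆ T := by
        intro k hk
        obtain ⟨i, rfl⟩ := σ.surjective k
        rw [hTσ]
        by_contra hi
        have := hmono ⟨m - 1, by omega⟩ i (Fin.mk_le_mk.2 (by omega))
        exact absurd ((hcon.trans this).trans_lt (hlt _ hk)) (lt_irrefl _)
      have := Finset.card_le_card hsub
      omega
    refine ⟨⟨fun h => (lt_min_iff.1 (key h)).1, fun hmM => ?_⟩,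
      fun h => (lt_min_iff.1 (key h)).2, ?_⟩
    · by_contra hcon
      rw [not_lt, orderStat_eq x (by omega) (by omega)] at hcon
      obtain ⟨T, hT, hTσ⟩ := exists_finset_perm_mem_iff (show m + 1 ≤ M by omega) σ
      have hsub : T ⊆ S := by
        intro k hk
        obtain ⟨i, rfl⟩ := σ.surjective k
        rw [hTσ] at hk
        by_contra hi
        have := hmono i ⟨m + 1 - 1, by omega⟩
          (Fin.mk_le_mk.2 (by omega) : i ≤ ⟨m + 1 - 1, by omega⟩)
        exact absurd (((hgt _ hi).1.trans_le this).trans_le hcon) (lt_irrefl _)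
      have := Finset.card_le_card hsub
      omega
    · rw [hlast]
      by_cases hk : σ ⟨M - 1, by omega⟩ ∈ S
      · exact ((hlt _ hk).trans_le (min_le_right _ _)).trans_le huw
      · exact (hgt _ hk).2

/-! ### Rates below the target -/

lemma eps_pos {R : ℝ} (hR : 0 < R) : 0 < eps R :=
  sub_pos.2 (Real.one_lt_rpow one_lt_two hR)

lemma rateI_lt_iff {Ps x R : ℝ} (hPs : 0 < Ps) (hx : 0 ≤ x) :
    rateI Ps x < R ↔ x < eps R / Ps := by
  rw [rateI, Real.logb_lt_iff_lt_rpow one_lt_two (by positivity), lt_div_iff₀' hPs, eps,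
    lt_sub_iff_add_lt']

lemma rateII_lt_iff {Ps P₀ y x R : ℝ} (hPs : 0 < Ps) (hP₀ : 0 < P₀) (hy : 0 ≤ y) (hx : 0 ≤ x) :
    rateII Ps P₀ y x < R ↔ x < eps R * (P₀ * y + 1) / Ps := by
  have h : 0 < P₀ * y + 1 := by positivity
  rw [rateII, Real.logb_lt_iff_lt_rpow one_lt_two (by positivity), lt_div_iff₀' hPs, eps,
    ← div_lt_iff₀ h, lt_sub_iff_add_lt']

/-- The outcomes, as pairs of the grant-free gains and the grant-based one, that make up the event
of probability `Q_m`. For `m = M` the bound on `R_{M,II}` is void, being weaker than the one on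
`R_{M,I}`. -/
noncomputable def outageEvent {M : ℕ} (Rs R₀ Ps P₀ : ℝ) (m : ℕ) : Set ((Fin M → ℝ) × ℝ) :=
  if m ≤ M then
    groupEvent (Ioi (eps R₀ / P₀)) (fun y => min (tau R₀ P₀ y / Ps) (eps Rs / Ps))
      (fun y => tau R₀ P₀ y / Ps) (fun y => eps Rs * (P₀ * y + 1) / Ps) m
  else
    groupEvent (Iio (eps R₀ / P₀)) (fun y => eps Rs * (P₀ * y + 1) / Ps)
      (fun y => eps Rs * (P₀ * y + 1) / Ps) (fun y => eps Rs * (P₀ * y + 1) / Ps) M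

lemma measurable_tau (R₀ P₀ : ℝ) : Measurable (tau R₀ P₀) := by
  unfold tau
  fun_prop

lemma measurableSet_outageEvent {M : ℕ} (Rs R₀ Ps P₀ : ℝ) (m : ℕ) :
    MeasurableSet (outageEvent (M := M) Rs R₀ Ps P₀ m) := by
  have := measurable_tau R₀ P₀
  unfold outageEvent
  split_ifs <;> apply measurableSet_groupEvent <;> measurability

lemma mem_groupEvent_full {M : ℕ} {A : Set ℝ} {a c b : ℝ → ℝ} {p : (Fin M → ℝ) × ℝ} :
    p ∈ groupEvent A a c b M ↔ p.2 ∈ A ∧ ∀ k, p.1 k < a p.2 := by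
  refine and_congr_right fun _ => ⟨?_, fun h => ⟨Finset.univ, by simp, by simpa using h, by simp⟩⟩
  rintro ⟨S, hS, h, -⟩ k
  have : S = Finset.univ := Finset.eq_univ_of_card _ (by simpa using hS)
  exact h k (this ▸ Finset.mem_univ k)

lemma gainSq_nonneg {Ω : Type*} (g : Ω → ℂ) (ω : Ω) : 0 ≤ gainSq g ω := sq_nonneg _

lemma gainsSq_nonneg {Ω : Type*} {M : ℕ} (h : Fin M → Ω → ℂ) (ω : Ω) (k : Fin M) :
    0 ≤ gainsSq h ω k := sq_nonneg _

section Channel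

variable {Ω : Type*} [MeasurableSpace Ω] {μ : Measure Ω} {M : ℕ} {g : Ω → ℂ} {h : Fin M → Ω → ℂ}

lemma Q_eq_measureReal_outageEvent (hM : 1 ≤ M)
    (hlaw : HasLaw (fun ω => (gainsSq h ω, gainSq g ω))
      ((Measure.pi fun _ : Fin M => expMeasure 1).prod (expMeasure 1)) μ)
    {Rs R₀ Ps P₀ : ℝ} (hRs : 0 < Rs) (hPs : 0 < Ps) (hP₀ : 0 < P₀) (m : ℕ) :
    Q μ g h Rs R₀ Ps P₀ m = ((Measure.pi fun _ : Fin M => expMeasure 1).prod (expMeasure 1)).real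
      (outageEvent Rs R₀ Ps P₀ m) := by
  have hmeas := measurableSet_outageEvent (M := M) Rs R₀ Ps P₀ m
  refine Eq.trans ?_ (hlaw.measureReal_eq (p := fun p => p ∈ outageEvent Rs R₀ Ps P₀ m) hmeas)
  have hs := eps_pos hRs
  rw [Q, outageEvent]
  split_ifs with hm
  · congr 1
    ext ω
    have hy := gainSq_nonneg g ω
    have huw : eps Rs / Ps ≤ eps Rs * (P₀ * gainSq g ω + 1) / Ps := by
      gcongr
      nlinarith [mul_nonneg hs.le (mul_nonneg hP₀.le hy)]
    simp only [mem_ofPred_eq, groupCond, groupEvent, mem_Ioi,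
      rateI_lt_iff hPs (orderStat_nonneg (gainsSq_nonneg h ω) _),
      rateII_lt_iff hPs hP₀ hy (orderStat_nonneg (gainsSq_nonneg h ω) _)]
    rw [← orderStat_conditions_iff hM hm _ huw]
    tauto
  · congr 1
    ext ω
    have hy := gainSq_nonneg g ω
    simp only [mem_ofPred_eq, mem_groupEvent_full, mem_Iio,
      rateII_lt_iff hPs hP₀ hy (orderStat_nonneg (gainsSq_nonneg h ω) _)]
    rw [and_comm]
    refine and_congr_right fun _ => ?_
    rw [orderStat_eq _ hM le_rfl]
    refine ⟨fun hlt k => ?_, fun hlt => hlt _⟩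
    obtain ⟨i, rfl⟩ := (Tuple.sort (gainsSq h ω)).surjective k
    exact (Tuple.monotone_sort (gainsSq h ω)
      (Fin.mk_le_mk.2 (by omega) : i ≤ ⟨M - 1, by omega⟩)).trans_lt hlt

lemma disjoint_outageEvent {Rs R₀ Ps P₀ : ℝ} {m n : ℕ} (hm : m < M + 2) (hn : n < M + 2)
    (hmn : m ≠ n) :
    Disjoint (outageEvent (M := M) Rs R₀ Ps P₀ m) (outageEvent Rs R₀ Ps P₀ n) := by
  rw [Set.disjoint_left]
  intro p hpm hpn
  unfold outageEvent at hpm hpn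
  split_ifs at hpm hpn with h1 h2 h2
  · obtain ⟨-, S, hS, hSlt, hSgt⟩ := hpm
    obtain ⟨-, T, hT, hTlt, hTgt⟩ := hpn
    have hST : S = T := by
      ext k
      constructor
      · intro hk
        by_contra hkT
        exact lt_asymm (lt_min_iff.1 (hSlt k hk)).1 (hTgt k hkT).1
      · intro hk
        by_contra hkS
        exact lt_asymm (lt_min_iff.1 (hTlt k hk)).1 (hSgt k hkS).1
    exact hmn (by rw [← hS, ← hT, hST])
  · exact lt_asymm (mem_Ioi.1 hpm.1) (mem_Iio.1 hpn.1)
  · exact lt_asymm (mem_Ioi.1 hpn.1) (mem_Iio.1 hpm.1)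
  · omega

/-- Off the null set of ties, outage means that one of the `outageEvent`s occurs: for
`|g|² > ε₀ / P₀` it is the one whose index is the number of users in Group 2, and for
`|g|² < ε₀ / P₀` Group 2 is empty because `τ = 0`. -/
lemma forall_userRate_lt_iff {x : Fin M → ℝ} {y Rs R₀ Ps P₀ : ℝ} (hR₀ : 0 < R₀)
    (hPs : 0 < Ps) (hP₀ : 0 < P₀) (hx : ∀ k, 0 ≤ x k) (hy : 0 ≤ y)
    (hne : y ≠ eps R₀ / P₀) (htie : ∀ k, x k ≠ tau R₀ P₀ y / Ps) :
    (∀ k, userRate R₀ Ps P₀ y (x k) < Rs) ↔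
      ∃ m ∈ Finset.range (M + 2), (x, y) ∈ outageEvent Rs R₀ Ps P₀ m := by
  have hrate : ∀ k, userRate R₀ Ps P₀ y (x k) < Rs ↔
      (x k < tau R₀ P₀ y / Ps ∧ x k < eps Rs / Ps) ∨
        (tau R₀ P₀ y / Ps < x k ∧ x k < eps Rs * (P₀ * y + 1) / Ps) := by
    intro k
    rw [userRate]
    split_ifs with hk <;> rw [← lt_div_iff₀' hPs] at hk
    · rw [rateI_lt_iff hPs (hx k)]
      simp [hk, hk.not_gt]
    · rw [rateII_lt_iff hPs hP₀ hy (hx k)]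
      simp [hk, lt_of_le_of_ne (not_lt.1 hk) (htie k).symm]
  simp only [hrate]
  rcases lt_or_gt_of_ne hne with hlt | hgt
  · have htau : tau R₀ P₀ y = 0 := by
      have : P₀ * y < eps R₀ := (lt_div_iff₀' hP₀).1 hlt
      have h2 : P₀ * y / eps R₀ < 1 := (div_lt_one (eps_pos hR₀)).2 this
      exact max_eq_left (by rw [eps] at h2; linarith)
    have hpos : ∀ k, 0 < x k := fun k =>
      lt_of_le_of_ne (hx k) (by simpa [htau] using (htie k).symm)
    constructor
    · intro hall
      refine ⟨M + 1, by simp, ?_⟩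
      rw [outageEvent, if_neg (by omega), mem_groupEvent_full]
      refine ⟨hlt, fun k => ?_⟩
      have := hall k
      simp only [htau, zero_div, (hpos k).not_gt, false_and, false_or] at this
      exact this.2
    · rintro ⟨m, -, hmem⟩ k
      rw [outageEvent] at hmem
      split_ifs at hmem
      · exact absurd (mem_Ioi.1 hmem.1) hlt.not_gt
      · rw [mem_groupEvent_full] at hmem
        exact Or.inr ⟨by simpa [htau] using hpos k, hmem.2 k⟩
  · constructor
    · intro hall
      classical
      let S : Finset (Fin M) := Finset.univ.filter fun k => x k < tau R₀ P₀ y / Ps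
      have hS : S.card ≤ M := by simpa using S.card_le_univ
      refine ⟨S.card, by simp; omega, ?_⟩
      rw [outageEvent, if_pos hS]
      refine ⟨hgt, S, rfl, fun k hk => ?_, fun k hk => ?_⟩
      · have hk' : x k < tau R₀ P₀ y / Ps := by simpa [S] using hk
        rcases hall k with h | h
        · exact lt_min h.1 h.2
        · exact absurd hk' h.1.not_gt
      · have hk' : ¬ x k < tau R₀ P₀ y / Ps := by simpa [S] using hk
        rcases hall k with h | h
        · exact absurd h.1 hk'
        · exact h
    · rintro ⟨m, -, hmem⟩ k
      rw [outageEvent] at hmem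
      split_ifs at hmem
      · obtain ⟨-, S, -, h1, h2⟩ := hmem
        by_cases hk : k ∈ S
        · exact Or.inl (lt_min_iff.1 (h1 k hk))
        · exact Or.inr (h2 k hk)
      · exact absurd (mem_Iio.1 hmem.1) hgt.not_gt

lemma ae_ne_ties (R₀ Ps P₀ : ℝ) :
    ∀ᵐ p ∂(Measure.pi fun _ : Fin M => expMeasure 1).prod (expMeasure 1),
      p.2 ≠ eps R₀ / P₀ ∧ ∀ k, p.1 k ≠ tau R₀ P₀ p.2 / Ps := by
  refine Filter.Eventually.and ?_ (ae_all_iff.2 fun k => ?_)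
  · exact Measure.quasiMeasurePreserving_snd.ae (p := fun y => y ≠ eps R₀ / P₀)
      (Measure.ae_ne _ _)
  · have := measurable_tau R₀ P₀
    have hmeas : MeasurableSet {p : (Fin M → ℝ) × ℝ | p.1 k = tau R₀ P₀ p.2 / Ps} :=
      measurableSet_eq_fun (by fun_prop) (by fun_prop)
    rw [ae_iff]
    simp only [ne_eq, not_not]
    rw [Measure.prod_apply_symm hmeas]
    refine (lintegral_congr fun y => ?_).trans lintegral_zero
    exact Measure.pi_hyperplane (fun _ : Fin M => expMeasure 1) k (tau R₀ P₀ y / Ps)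

lemma admittedRate_lt_iff (hM : 1 ≤ M) {R₀ Ps P₀ y R : ℝ} {x : Fin M → ℝ} :
    admittedRate R₀ Ps P₀ y x < R ↔ ∀ k, userRate R₀ Ps P₀ y (x k) < R := by
  have : Nonempty (Fin M) := ⟨⟨0, by omega⟩⟩
  refine ⟨fun hlt k => (le_ciSup (Set.finite_range _).bddAbove k).trans_lt hlt, fun hall => ?_⟩
  obtain ⟨k, hk⟩ := exists_eq_ciSup_of_finite (f := fun k => userRate R₀ Ps P₀ y (x k))
  rw [admittedRate, ← hk]
  exact hall k

lemma Pout_eq_sum_Q (hM : 1 ≤ M)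
    (hlaw : HasLaw (fun ω => (gainsSq h ω, gainSq g ω))
      ((Measure.pi fun _ : Fin M => expMeasure 1).prod (expMeasure 1)) μ)
    {Rs R₀ Ps P₀ : ℝ} (hRs : 0 < Rs) (hR₀ : 0 < R₀) (hPs : 0 < Ps) (hP₀ : 0 < P₀) :
    Pout μ g h Rs R₀ Ps P₀ = ∑ m ∈ Finset.range (M + 2), Q μ g h Rs R₀ Ps P₀ m := by
  simp only [Q_eq_measureReal_outageEvent hM hlaw hRs hPs hP₀]
  rw [← measureReal_biUnion_finset
    (fun m hm n hn hmn => disjoint_outageEvent (Finset.mem_range.1 (Finset.mem_coe.1 hm))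
      (Finset.mem_range.1 (Finset.mem_coe.1 hn)) hmn)
    (fun m _ => measurableSet_outageEvent _ _ _ _ m),
    ← hlaw.map_eq, map_measureReal_apply_of_aemeasurable hlaw.aemeasurable
      (Finset.measurableSet_biUnion _ fun m _ => measurableSet_outageEvent _ _ _ _ m)]
  refine measureReal_congr ?_
  have hties := ae_ne_ties (M := M) R₀ Ps P₀
  rw [← hlaw.map_eq] at hties
  filter_upwards [ae_of_ae_map hlaw.aemeasurable hties] with ω hω
  refine propext ?_
  change admittedRate R₀ Ps P₀ (gainSq g ω) (gainsSq h ω) < Rs ↔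
    (gainsSq h ω, gainSq g ω) ∈ ⋃ m ∈ Finset.range (M + 2), outageEvent Rs R₀ Ps P₀ m
  rw [admittedRate_lt_iff hM, forall_userRate_lt_iff hR₀ hPs hP₀ (gainsSq_nonneg h ω)
    (gainSq_nonneg g ω) hω.1 hω.2]
  simp only [mem_iUnion, exists_prop]

end Channel

/-! ### Bounds on the `Q_m` at equal transmit powers -/

/-- The integrand of the rescaled `Q_m`, `m < M`: for `v = P |g|²` it is the Lebesgue volume of the
set of rescaled grant-free gains for which the outage event occurs. Only its values for
`z ≤ v ≤ z * alphaTwo s z` matter, where `τ = v / z - 1`. -/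
noncomputable def volumeDensity (M : ℕ) (s z : ℝ) (m : ℕ) (v : ℝ) : ℝ :=
  M.choose m * (min (v / z - 1) s ^ m * (s * (v + 1) - (v / z - 1)) ^ (M - m))

/-- The volume of the rescaled outage event, which is the limit of `P ^ (M + 1) * Q_m`, `m < M`. -/
noncomputable def limitVolume (M : ℕ) (s z : ℝ) (m : ℕ) : ℝ :=
  ∫ v in z..z * alphaTwo s z, volumeDensity M s z m v

lemma continuous_volumeDensity (M : ℕ) (s z : ℝ) (m : ℕ) : Continuous (volumeDensity M s z m) := by
  unfold volumeDensity
  fun_prop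

/-- The threshold `τ = v / z - 1` stays below the bound `s * (v + 1)` for Group 1 exactly up to
`v = z * alphaTwo s z`. -/
lemma gap_pos_iff {s z v : ℝ} (hz : 0 < z) (hsz : s * z < 1) :
    0 < s * (v + 1) - (v / z - 1) ↔ v < z * alphaTwo s z := by
  have h : s * (v + 1) - (v / z - 1) = (z * (1 + s) - v * (1 - z * s)) / z := by
    field_simp
    ring
  have h1 : 0 < 1 - z * s := by linarith [mul_comm s z]
  rw [h, alphaTwo, ← mul_div_assoc, lt_div_iff₀ h1, div_pos_iff_of_pos_right hz, sub_pos]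

lemma lt_mul_alphaTwo {s z : ℝ} (hs : 0 < s) (hz : 0 < z) (hsz : s * z < 1) :
    z * (1 + s) < z * alphaTwo s z := by
  rw [← gap_pos_iff hz hsz]
  have : z * (1 + s) / z = 1 + s := by field_simp
  rw [this]
  nlinarith [mul_pos hs (mul_pos hz (by linarith : 0 < 1 + s))]

lemma tau_div {R₀ P : ℝ} (hP : 0 < P) (v : ℝ) :
    tau R₀ P (v / P) = max 0 (v / eps R₀ - 1) := by
  rw [tau, mul_div_cancel₀ _ hP.ne', eps]

/-- The factors `P` cancel the decay of the interval probabilities, up to the bounds on the density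
of the exponential law. -/
lemma scaled_box_bounds {a c b K P : ℝ} (hP : 0 < P) (ha : 0 ≤ a) (haK : a ≤ K) (hc : 0 ≤ c)
    (hcb : c ≤ b) (hbK : b ≤ K) (m n : ℕ) :
    Real.exp (-(((m + n : ℕ) : ℝ) * K / P)) * (a ^ m * (b - c) ^ n) ≤
        P ^ (m + n) * ((expMeasure 1).real (Iio (a / P)) ^ m *
          (expMeasure 1).real (Ioo (c / P) (b / P)) ^ n) ∧
      P ^ (m + n) * ((expMeasure 1).real (Iio (a / P)) ^ m *
          (expMeasure 1).real (Ioo (c / P) (b / P)) ^ n) ≤ a ^ m * (b - c) ^ n := by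
  have hbc : 0 ≤ b - c := sub_nonneg.2 hcb
  have hdiv : b / P - c / P = (b - c) / P := by ring
  have h1 : P * (expMeasure 1).real (Iio (a / P)) ≤ a := by
    have := mul_le_mul_of_nonneg_left (expMeasure_one_real_Iio_le (div_nonneg ha hP.le)) hP.le
    rwa [mul_div_cancel₀ _ hP.ne'] at this
  have h2 : P * (expMeasure 1).real (Ioo (c / P) (b / P)) ≤ b - c := by
    have := mul_le_mul_of_nonneg_left
      (expMeasure_one_real_Ioo_le (div_le_div_of_nonneg_right hcb hP.le)) hP.le
    rwa [hdiv, mul_div_cancel₀ _ hP.ne'] at this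
  have h3 : Real.exp (-(K / P)) * a ≤ P * (expMeasure 1).real (Iio (a / P)) := by
    have := mul_le_mul_of_nonneg_left (le_expMeasure_one_real_Iio (div_nonneg ha hP.le)) hP.le
    rw [mul_left_comm, mul_div_cancel₀ _ hP.ne'] at this
    refine le_trans (mul_le_mul_of_nonneg_right (Real.exp_le_exp.2 ?_) ha) this
    gcongr
  have h4 : Real.exp (-(K / P)) * (b - c) ≤ P * (expMeasure 1).real (Ioo (c / P) (b / P)) := by
    have := mul_le_mul_of_nonneg_left
      (le_expMeasure_one_real_Ioo (div_nonneg hc hP.le) (div_le_div_of_nonneg_right hcb hP.le))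
      hP.le
    rw [hdiv, mul_left_comm, mul_div_cancel₀ _ hP.ne'] at this
    refine le_trans (mul_le_mul_of_nonneg_right (Real.exp_le_exp.2 ?_) hbc) this
    gcongr
  have hsplit : P ^ (m + n) * ((expMeasure 1).real (Iio (a / P)) ^ m *
      (expMeasure 1).real (Ioo (c / P) (b / P)) ^ n) =
      (P * (expMeasure 1).real (Iio (a / P))) ^ m *
        (P * (expMeasure 1).real (Ioo (c / P) (b / P))) ^ n := by
    rw [mul_pow, mul_pow, pow_add]
    ring
  have hexp : Real.exp (-(((m + n : ℕ) : ℝ) * K / P)) * (a ^ m * (b - c) ^ n) =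
      (Real.exp (-(K / P)) * a) ^ m * (Real.exp (-(K / P)) * (b - c)) ^ n := by
    rw [mul_pow, mul_pow, mul_mul_mul_comm, ← pow_add, ← Real.exp_nat_mul]
    congr 2
    ring
  rw [hsplit, hexp]
  constructor <;> gcongr

section Channel

variable {Ω : Type*} [MeasurableSpace Ω] {μ : Measure Ω} {M : ℕ} {g : Ω → ℂ} {h : Fin M → Ω → ℂ}
  {Rs R₀ P : ℝ}

lemma Q_bounds_of_lt (hM : 1 ≤ M)
    (hlaw : HasLaw (fun ω => (gainsSq h ω, gainSq g ω))
      ((Measure.pi fun _ : Fin M => expMeasure 1).prod (expMeasure 1)) μ)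
    (hRs : 0 < Rs) (hR₀ : 0 < R₀) (hε : eps Rs * eps R₀ < 1) (hP : 0 < P) {m : ℕ} (hm : m < M) :
    Real.exp (-((eps R₀ * alphaTwo (eps Rs) (eps R₀) +
          M * (eps Rs * (eps R₀ * alphaTwo (eps Rs) (eps R₀) + 1))) / P)) *
        limitVolume M (eps Rs) (eps R₀) m ≤ P ^ (M + 1) * Q μ g h Rs R₀ P P m ∧
      P ^ (M + 1) * Q μ g h Rs R₀ P P m ≤ limitVolume M (eps Rs) (eps R₀) m := by
  have hs := eps_pos hRs
  have hz := eps_pos hR₀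
  have htau := measurable_tau R₀ P
  have hα := lt_mul_alphaTwo hs hz hε
  set s := eps Rs
  set z := eps R₀
  set w := z * alphaTwo s z with hw
  have hzw : z ≤ w := by nlinarith
  set F : ℝ → ℝ := fun y => (expMeasure 1).real (Iio (min (tau R₀ P y / P) (s / P))) ^ m *
    (expMeasure 1).real (Ioo (tau R₀ P y / P) (s * (P * y + 1) / P)) ^ (M - m) with hF
  have hFm : Measurable F :=
    ((measurable_expMeasure_one_real_Iio (by fun_prop)).pow_const _).mul
      ((measurable_expMeasure_one_real_Ioo (by fun_prop) (by fun_prop)).pow_const _)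
  have hQ : Q μ g h Rs R₀ P P m =
      ∫ y in Ioo (z / P) (w / P), M.choose m * F y ∂expMeasure 1 := by
    rw [Q_eq_measureReal_outageEvent hM hlaw hRs hP hP, outageEvent, if_pos hm.le,
      measureReal_groupEvent measurableSet_Ioi (by fun_prop) (by fun_prop) (by fun_prop)
        (fun y _ => min_le_left _ _), integral_const_mul]
    congr 1
    -- beyond `w / P` no gain is above the threshold and below the bound for Group 1
    refine (setIntegral_eq_of_subset_of_forall_sdiff_eq_zero measurableSet_Ioi
      Ioo_subset_Ioi_self fun y hy => ?_)
    have hyw : w ≤ P * y := by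
      by_contra hcon
      exact hy.2 ⟨hy.1, (lt_div_iff₀' hP).2 (not_le.1 hcon)⟩
    have hgap := (not_congr (gap_pos_iff (v := P * y) hz hε)).2 (not_lt.2 hyw)
    have hempty : Ioo (tau R₀ P y / P) (s * (P * y + 1) / P) = ∅ := by
      refine Ioo_eq_empty (not_lt.2 ?_)
      gcongr
      have : tau R₀ P y = max 0 (P * y / z - 1) := rfl
      rw [this]
      exact le_max_of_le_right (by linarith)
    change F y = 0
    simp only [hF, hempty, measureReal_empty]
    rw [zero_pow (by omega), mul_zero]
  have key : ∀ v ∈ Ioo z w, ∀ r : ℝ, r = P ^ M * (M.choose m * F (v / P)) →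
      Real.exp (-(M * (s * (w + 1)) / P)) * volumeDensity M s z m v ≤ r ∧
        r ≤ volumeDensity M s z m v := by
    rintro v ⟨hv1, hv2⟩ r rfl
    have hgap : 0 < s * (v + 1) - (v / z - 1) := (gap_pos_iff hz hε).2 hv2
    have hτ : 0 < v / z - 1 := sub_pos.2 ((one_lt_div hz).2 hv1)
    have htauv : tau R₀ P (v / P) = v / z - 1 := by
      rw [tau_div hP]
      exact max_eq_right hτ.le
    have hvw : s * (v + 1) ≤ s * (w + 1) := by gcongr
    have hb := scaled_box_bounds (a := min (v / z - 1) s) (c := v / z - 1) (b := s * (v + 1))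
      (K := s * (w + 1)) hP (le_min hτ.le hs.le)
      (by linarith [min_le_left (v / z - 1) s]) hτ.le (by linarith) hvw m (M - m)
    have hFv : F (v / P) = (expMeasure 1).real (Iio (min (v / z - 1) s / P)) ^ m *
        (expMeasure 1).real (Ioo ((v / z - 1) / P) (s * (v + 1) / P)) ^ (M - m) := by
      simp only [hF, htauv, mul_div_cancel₀ _ hP.ne', min_div_div_right hP.le]
    rw [Nat.add_sub_cancel' hm.le, ← hFv] at hb
    have hC : (0 : ℝ) ≤ M.choose m := Nat.cast_nonneg _
    rw [volumeDensity, mul_left_comm (P ^ M), mul_left_comm (Real.exp _)]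
    exact ⟨mul_le_mul_of_nonneg_left hb.1 hC, mul_le_mul_of_nonneg_left hb.2 hC⟩
  rw [hQ]
  refine scaled_setIntegral_expMeasure_one_bounds hz.le hzw hP (hFm.const_mul _)
    (continuous_volumeDensity M s z m) (fun v hv => ?_) (fun v hv => (key v hv _ rfl).1)
    (fun v hv => (key v hv _ rfl).2)
  have hgap : 0 < s * (v + 1) - (v / z - 1) := (gap_pos_iff hz hε).2 hv.2
  have hτ : 0 < min (v / z - 1) s := lt_min (sub_pos.2 ((one_lt_div hz).2 hv.1)) hs
  rw [volumeDensity]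
  positivity

lemma Q_last_bounds (hM : 1 ≤ M)
    (hlaw : HasLaw (fun ω => (gainsSq h ω, gainSq g ω))
      ((Measure.pi fun _ : Fin M => expMeasure 1).prod (expMeasure 1)) μ)
    (hRs : 0 < Rs) (hR₀ : 0 < R₀) (hP : 0 < P) :
    Real.exp (-((eps R₀ + M * (eps Rs * (eps R₀ + 1))) / P)) *
        ∫ v in (0 : ℝ)..eps R₀, (eps Rs * (v + 1)) ^ M ≤ P ^ (M + 1) * Q μ g h Rs R₀ P P (M + 1) ∧
      P ^ (M + 1) * Q μ g h Rs R₀ P P (M + 1) ≤ ∫ v in (0 : ℝ)..eps R₀, (eps Rs * (v + 1)) ^ M := by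
  have hs := eps_pos hRs
  have hz := eps_pos hR₀
  set s := eps Rs
  set z := eps R₀
  set F : ℝ → ℝ := fun y => (expMeasure 1).real (Iio (s * (P * y + 1) / P)) ^ M with hF
  have hFm : Measurable F := (measurable_expMeasure_one_real_Iio (by fun_prop)).pow_const _
  have hpos : ∀ᵐ t ∂(expMeasure 1), 0 < t := by
    rw [ae_iff]
    simpa [Iic] using expMeasure_one_Iic_zero
  have hQ : Q μ g h Rs R₀ P P (M + 1) = ∫ y in Ioo (0 / P) (z / P), F y ∂expMeasure 1 := by
    rw [Q_eq_measureReal_outageEvent hM hlaw hRs hP hP, outageEvent, if_neg (by omega),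
      measureReal_groupEvent measurableSet_Iio (by fun_prop) (by fun_prop) (by fun_prop)
        (fun y _ => le_rfl), zero_div]
    simp only [Nat.choose_self, Nat.cast_one, one_mul, Nat.sub_self, pow_zero, mul_one]
    refine setIntegral_congr_set ?_
    filter_upwards [hpos] with t ht
    exact propext ⟨fun hlt => ⟨ht, hlt⟩, fun hlt => hlt.2⟩
  have key : ∀ v ∈ Ioo 0 z, ∀ r : ℝ, r = P ^ M * F (v / P) →
      Real.exp (-(M * (s * (z + 1)) / P)) * (s * (v + 1)) ^ M ≤ r ∧ r ≤ (s * (v + 1)) ^ M := by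
    rintro v ⟨hv1, hv2⟩ r rfl
    have hvw : s * (v + 1) ≤ s * (z + 1) := by gcongr
    have hb := scaled_box_bounds (a := s * (v + 1)) (c := 0) (b := 0)
      (K := s * (z + 1)) hP (by positivity) hvw le_rfl le_rfl (by positivity) M 0
    simpa [hF, mul_div_cancel₀ _ hP.ne'] using hb
  rw [hQ]
  exact scaled_setIntegral_expMeasure_one_bounds le_rfl hz.le hP hFm
    (by fun_prop) (fun v hv => by have := hv.1; positivity) (fun v hv => (key v hv _ rfl).1)
    (fun v hv => (key v hv _ rfl).2)

lemma measureReal_groupEvent_full_const {A : Set ℝ} (hA : MeasurableSet A) (a : ℝ) :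
    ((Measure.pi fun _ : Fin M => expMeasure 1).prod (expMeasure 1)).real
      (groupEvent A (fun _ => a) (fun _ => a) (fun _ => a) M) =
      (expMeasure 1).real A * (expMeasure 1).real (Iio a) ^ M := by
  rw [measureReal_groupEvent hA (by fun_prop) (by fun_prop) (by fun_prop) (fun y _ => le_rfl)]
  simp

/-- If all users are in Group 2, then `|g|²` is unbounded, and up to a factor that tends to `1`
only the bound on the gains of the grant-free users counts. -/
lemma Q_full_bounds (hM : 1 ≤ M)
    (hlaw : HasLaw (fun ω => (gainsSq h ω, gainSq g ω))
      ((Measure.pi fun _ : Fin M => expMeasure 1).prod (expMeasure 1)) μ)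
    (hRs : 0 < Rs) (hR₀ : 0 < R₀) (hP : 0 < P) :
    Real.exp (-((eps R₀ * (1 + eps Rs) + M * eps Rs) / P)) * (eps Rs ^ M / P ^ M) ≤
        Q μ g h Rs R₀ P P M ∧
      Q μ g h Rs R₀ P P M ≤ eps Rs ^ M / P ^ M := by
  have hs := eps_pos hRs
  have hz := eps_pos hR₀
  rw [Q_eq_measureReal_outageEvent hM hlaw hRs hP hP, outageEvent, if_pos le_rfl]
  set s := eps Rs
  set z := eps R₀
  have hsP : 0 ≤ s / P := by positivity
  constructor
  · have hsub : groupEvent (M := M) (Ioi (z * (1 + s) / P)) (fun _ => s / P) (fun _ => s / P)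
        (fun _ => s / P) M ⊆ groupEvent (Ioi (z / P)) (fun y => min (tau R₀ P y / P) (s / P))
          (fun y => tau R₀ P y / P) (fun y => s * (P * y + 1) / P) M := by
      intro p hp
      rw [mem_groupEvent_full] at hp ⊢
      have hp1 : z * (1 + s) < P * p.2 := (div_lt_iff₀' hP).1 hp.1
      refine ⟨(div_lt_iff₀' hP).2 (by nlinarith), fun k => lt_min ?_ (hp.2 k)⟩
      refine (hp.2 k).trans ?_
      gcongr
      have : tau R₀ P p.2 = max 0 (P * p.2 / z - 1) := rfl
      rw [this]
      refine lt_max_of_lt_right ?_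
      rw [lt_sub_iff_add_lt, lt_div_iff₀ hz]
      linarith
    refine le_trans ?_ (measureReal_mono hsub)
    rw [measureReal_groupEvent_full_const measurableSet_Ioi]
    have h1 := le_expMeasure_one_real_Ioi (a := z * (1 + s) / P) (by positivity)
    have h2 := le_expMeasure_one_real_Iio hsP
    calc _ = Real.exp (-(z * (1 + s) / P)) * (Real.exp (-(s / P)) * (s / P)) ^ M := by
          rw [mul_pow, ← Real.exp_nat_mul, ← mul_assoc, ← Real.exp_add, div_pow]
          congr 2
          ring
      _ ≤ _ := by gcongr
  · have hsub : groupEvent (M := M) (Ioi (z / P)) (fun y => min (tau R₀ P y / P) (s / P))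
          (fun y => tau R₀ P y / P) (fun y => s * (P * y + 1) / P) M ⊆
        groupEvent univ (fun _ => s / P) (fun _ => s / P) (fun _ => s / P) M := by
      intro p hp
      rw [mem_groupEvent_full] at hp ⊢
      exact ⟨mem_univ _, fun k => (lt_min_iff.1 (hp.2 k)).2⟩
    refine (measureReal_mono hsub).trans ?_
    rw [measureReal_groupEvent_full_const MeasurableSet.univ, ← div_pow, probReal_univ, one_mul]
    gcongr
    exact expMeasure_one_real_Iio_le hsP

end Channel

/-! ### Closed forms of the limit volumes -/

lemma limitVolume_pos {M m : ℕ} (hm : m ≤ M) {s z : ℝ} (hs : 0 < s) (hz : 0 < z) (hsz : s * z < 1) :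
    0 < limitVolume M s z m := by
  have hα := lt_mul_alphaTwo hs hz hsz
  refine intervalIntegral.intervalIntegral_pos_of_pos_on
    ((continuous_volumeDensity M s z m).intervalIntegrable _ _) (fun v hv => ?_) (by nlinarith)
  have hgap : 0 < s * (v + 1) - (v / z - 1) := (gap_pos_iff hz hsz).2 hv.2
  have hτ : 0 < min (v / z - 1) s := lt_min (sub_pos.2 ((one_lt_div hz).2 hv.1)) hs
  have hC : (0 : ℝ) < M.choose m := Nat.cast_pos.2 (Nat.choose_pos hm)
  rw [volumeDensity]
  positivity

lemma integral_pow_mul_affine_pow (m n : ℕ) (a b p q : ℝ) :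
    ∫ x in a..b, x ^ m * (p + q * x) ^ n = ∑ i ∈ Finset.range (n + 1),
      (n.choose i : ℝ) * p ^ (n - i) * q ^ i *
        ((b ^ (m + i + 1) - a ^ (m + i + 1)) / ((m : ℝ) + (i : ℝ) + 1)) := by
  have h : ∀ x : ℝ, x ^ m * (p + q * x) ^ n = ∑ i ∈ Finset.range (n + 1),
      (n.choose i : ℝ) * p ^ (n - i) * q ^ i * x ^ (m + i) := by
    intro x
    rw [add_comm p, add_pow, Finset.mul_sum]
    refine Finset.sum_congr rfl fun i _ => ?_
    rw [mul_pow, pow_add]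
    ring
  simp only [h]
  rw [intervalIntegral.integral_finsetSum
    fun i _ => (by fun_prop : Continuous _).intervalIntegrable _ _]
  refine Finset.sum_congr rfl fun i _ => ?_
  rw [intervalIntegral.integral_const_mul, integral_pow]
  push_cast
  rfl

/-- The range of integration is split at `z * (1 + s)`, where the threshold `v / z - 1` exceeds
`s`; below that point the integral is expressed in the variable `v / z - 1`. -/
lemma limitVolume_eq {M m : ℕ} {s z : ℝ} (hs : 0 < s) (hz : 0 < z) (hsz : s * z < 1) :
    limitVolume M s z m = M.choose m *
      (z * (∫ x in (0 : ℝ)..s, x ^ m * ((s + z * s) + z * (s - z⁻¹) * x) ^ (M - m)) +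
        s ^ m * ∫ v in z * (1 + s)..z * alphaTwo s z, ((s + 1) + (s - z⁻¹) * v) ^ (M - m)) := by
  have hα := lt_mul_alphaTwo hs hz hsz
  have hcont := continuous_volumeDensity M s z m
  rw [limitVolume, ← intervalIntegral.integral_add_adjacent_intervals
    (hcont.intervalIntegrable z (z * (1 + s))) (hcont.intervalIntegrable _ _),
    mul_add (M.choose m : ℝ)]
  congr 1
  · have hsub := intervalIntegral.integral_comp_mul_add (a := 0) (b := s)
      (volumeDensity M s z m) hz.ne' z
    rw [mul_zero, zero_add, show z * s + z = z * (1 + s) by ring, smul_eq_mul] at hsub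
    rw [← mul_inv_cancel_left₀ hz.ne' (∫ v in z..z * (1 + s), volumeDensity M s z m v), ← hsub,
      mul_left_comm, ← intervalIntegral.integral_const_mul (M.choose m : ℝ)]
    congr 1
    refine intervalIntegral.integral_congr fun x hx => ?_
    rw [uIcc_of_le hs.le] at hx
    have h1 : (z * x + z) / z - 1 = x := by field_simp; ring
    simp only [volumeDensity]
    rw [h1, min_eq_left hx.2]
    congr 3
    field_simp
    ring
  · rw [← mul_assoc, ← intervalIntegral.integral_const_mul]
    refine intervalIntegral.integral_congr fun v hv => ?_
    rw [uIcc_of_le hα.le] at hv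
    have h1 : s ≤ v / z - 1 := by
      rw [le_sub_iff_add_le, le_div_iff₀ hz]
      linarith [hv.1]
    simp only [volumeDensity]
    rw [min_eq_right h1, ← mul_assoc]
    congr 2
    field_simp
    ring

lemma etaBar_eq {M m : ℕ} (hm : m ≤ M) : etaBar M m = M.choose m := by
  rw [etaBar, Nat.cast_choose ℝ hm]

lemma etaTilde_eq {M : ℕ} (hM : 2 ≤ M) : etaTilde M = M * (M - 1) := by
  obtain ⟨n, rfl⟩ := Nat.exists_eq_add_of_le' hM
  have : ((n.factorial : ℕ) : ℝ) ≠ 0 := Nat.cast_ne_zero.2 n.factorial_ne_zero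
  rw [etaTilde, Nat.add_sub_cancel, Nat.factorial_succ, Nat.factorial_succ]
  push_cast
  field_simp
  ring

lemma approxMid_eq {M m : ℕ} (hm : m ≤ M) {s z : ℝ} (hs : 0 < s) (hz : 0 < z) (hsz : s * z < 1)
    (P : ℝ) : approxMid M s z P m = limitVolume M s z m / P ^ (M + 1) := by
  have h0 := integral_pow_mul_affine_pow 0 (M - m) (z * (1 + s)) (z * alphaTwo s z) (s + 1)
    (s - z⁻¹)
  simp only [pow_zero, one_mul] at h0
  rw [limitVolume_eq hs hz hsz, integral_pow_mul_affine_pow, h0, approxMid, etaBar_eq hm]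
  have e1 : (∑ i ∈ Finset.range (M - m + 1), ((M - m).choose i : ℝ) * (s + 1) ^ (M - m - i) *
      (s - z⁻¹) ^ i * z ^ (i + 1) *
        ((alphaTwo s z ^ (i + 1) - (1 + s) ^ (i + 1)) / ((i : ℝ) + 1))) =
      ∑ i ∈ Finset.range (M - m + 1), ((M - m).choose i : ℝ) * (s + 1) ^ (M - m - i) *
        (s - z⁻¹) ^ i * (((z * alphaTwo s z) ^ (0 + i + 1) - (z * (1 + s)) ^ (0 + i + 1)) /
          (((0 : ℕ) : ℝ) + (i : ℝ) + 1)) := by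
    refine Finset.sum_congr rfl fun i _ => ?_
    rw [zero_add, Nat.cast_zero, zero_add, mul_pow, mul_pow]
    ring
  have e2 : (∑ i ∈ Finset.range (M - m + 1), ((M - m).choose i : ℝ) * (s + z * s) ^ (M - m - i) *
      (s - z⁻¹) ^ i * z ^ (i + 1) * (s ^ (m + i + 1) / ((m : ℝ) + (i : ℝ) + 1))) =
      z * ∑ i ∈ Finset.range (M - m + 1), ((M - m).choose i : ℝ) * (s + z * s) ^ (M - m - i) *
        (z * (s - z⁻¹)) ^ i * ((s ^ (m + i + 1) - 0 ^ (m + i + 1)) / ((m : ℝ) + (i : ℝ) + 1)) := by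
    rw [Finset.mul_sum]
    refine Finset.sum_congr rfl fun i _ => ?_
    rw [zero_pow (Nat.succ_ne_zero _), sub_zero, mul_pow]
    ring
  rw [e1, e2]
  ring

lemma approxZero_eq {M : ℕ} (hM : 2 ≤ M) {s z : ℝ} (hs : 0 < s) (hz : 0 < z) (hsz : s * z < 1)
    (P : ℝ) : approxZero M s z P = Real.exp (M / P) * (limitVolume M s z 0 / P ^ (M + 1)) := by
  have hα := lt_mul_alphaTwo hs hz hsz
  have hM0 : (M : ℝ) ≠ 0 := by positivity
  have hM1 : (M : ℝ) - 1 ≠ 0 := by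
    have : (2 : ℝ) ≤ M := by exact_mod_cast hM
    linarith
  have hV : limitVolume M s z 0 = ∑ i ∈ Finset.range (M + 1),
      (M.choose i : ℝ) * (s + 1) ^ (M - i) * (s - z⁻¹) ^ i *
        z ^ (i + 1) * ((alphaTwo s z ^ (i + 1) - 1) / ((i : ℝ) + 1)) := by
    have h0 := integral_pow_mul_affine_pow 0 M z (z * alphaTwo s z) (s + 1) (s - z⁻¹)
    have hint : limitVolume M s z 0 =
        ∫ x in z..z * alphaTwo s z, x ^ 0 * ((s + 1) + (s - z⁻¹) * x) ^ M := by
      refine intervalIntegral.integral_congr fun v _ => ?_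
      simp only [volumeDensity, Nat.choose_zero_right, Nat.cast_one, pow_zero, one_mul,
        Nat.sub_zero]
      congr 1
      field_simp
      ring
    rw [hint, h0]
    refine Finset.sum_congr rfl fun i _ => ?_
    rw [zero_add, Nat.cast_zero, zero_add, mul_pow]
    ring
  rw [approxZero, ← hV, etaTilde_eq hM]
  field_simp

lemma approxLast_eq (M : ℕ) (s z P : ℝ) :
    approxLast M s z P = (∫ v in (0 : ℝ)..z, (s * (v + 1)) ^ M) / P ^ (M + 1) := by
  simp only [mul_pow]
  rw [intervalIntegral.integral_const_mul,
    intervalIntegral.integral_comp_add_right (fun v => v ^ M) 1, integral_pow, approxLast, zero_add,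
    one_pow, add_comm z 1]
  rw [mul_comm (P ^ (M + 1)), ← div_div, mul_div_assoc]

/-- Positivity of the volume of the rescaled event for `Q_{M+1}`. -/
lemma integral_last_pos (M : ℕ) {s z : ℝ} (hs : 0 < s) (hz : 0 < z) :
    0 < ∫ v in (0 : ℝ)..z, (s * (v + 1)) ^ M :=
  intervalIntegral.intervalIntegral_pos_of_pos_on
    ((by fun_prop : Continuous _).intervalIntegrable _ _)
    (fun v hv => by have := hv.1; positivity) hz

lemma approxFull_sub (M : ℕ) {s z : ℝ} (hz : 0 < z) (P : ℝ) :
    approxFull M s z P - s ^ M / P ^ M = (z * s ^ (M + 1) / (M + 1)) / P ^ (M + 1) := by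
  rw [approxFull, add_sub_cancel_right, pow_succ z]
  field_simp

/-- `P ^ (M + 1) * approxPenult M s z P`, which does not depend on `P`. -/
noncomputable def penultConst (M : ℕ) (s z : ℝ) : ℝ :=
  M * (1 + s) * s ^ (M - 1) * z * ((alphaTwo s z - 1 - s) + s / M)

lemma approxPenult_eq {M : ℕ} (hM : 2 ≤ M) (s z P : ℝ) :
    approxPenult M s z P = penultConst M s z / P ^ (M + 1) := by
  have hM1 : (M : ℝ) - 1 ≠ 0 := by
    have : (2 : ℝ) ≤ M := by exact_mod_cast hM
    linarith
  rw [approxPenult, penultConst, etaTilde_eq hM]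
  field_simp

lemma penultConst_pos {M : ℕ} (hM : 2 ≤ M) {s z : ℝ} (hs : 0 < s) (hz : 0 < z)
    (hsz : s * z < 1) : 0 < penultConst M s z := by
  have hα : 1 + s < alphaTwo s z := lt_of_mul_lt_mul_left (lt_mul_alphaTwo hs hz hsz) hz.le
  have : 0 < alphaTwo s z - 1 - s := by linarith
  have : (0 : ℝ) < M := by positivity
  rw [penultConst]
  positivity

/-- The constant for `Q_{M-1}` comes from replacing the width `s * (v + 1) - τ` of the range left to
the strongest user by its upper bound `1 + s`. -/
lemma limitVolume_penult_le {M : ℕ} (hM : 2 ≤ M) {s z : ℝ} (hs : 0 < s) (hz : 0 < z)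
    (hsz : s * z < 1) : limitVolume M s z (M - 1) ≤ penultConst M s z := by
  have hα := lt_mul_alphaTwo hs hz hsz
  have hq : s - z⁻¹ ≤ 0 := by
    rw [sub_nonpos, ← one_div, le_div_iff₀ hz]
    exact hsz.le
  have hMpos : (0 : ℝ) < M := by positivity
  have hchoose : M.choose (M - 1) = M := by
    rw [Nat.choose_symm (by omega : 1 ≤ M), Nat.choose_one_right]
  have hcast : ((M - 1 : ℕ) : ℝ) + 1 = M := by
    rw [Nat.cast_sub (by omega), Nat.cast_one, sub_add_cancel]
  rw [limitVolume_eq hs hz hsz, hchoose, Nat.sub_sub_self (by omega : 1 ≤ M)]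
  simp only [pow_one]
  have h1 : ∫ x in (0 : ℝ)..s, x ^ (M - 1) * ((s + z * s) + z * (s - z⁻¹) * x) ≤
      (1 + s) * (s ^ M / M) := by
    have hle : ∫ x in (0 : ℝ)..s, x ^ (M - 1) * ((s + z * s) + z * (s - z⁻¹) * x) ≤
        ∫ x in (0 : ℝ)..s, x ^ (M - 1) * (1 + s) := by
      refine intervalIntegral.integral_mono_on hs.le
        ((by fun_prop : Continuous _).intervalIntegrable _ _)
        ((by fun_prop : Continuous _).intervalIntegrable _ _) fun x hx => ?_
      have hx0 : 0 ≤ x := hx.1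
      have : z * (s - z⁻¹) * x ≤ 0 :=
        mul_nonpos_of_nonpos_of_nonneg (mul_nonpos_of_nonneg_of_nonpos hz.le hq) hx0
      refine mul_le_mul_of_nonneg_left ?_ (pow_nonneg hx0 _)
      linarith [mul_comm s z]
    refine hle.trans_eq ?_
    rw [intervalIntegral.integral_mul_const, integral_pow, hcast,
      Nat.sub_add_cancel (by omega : 1 ≤ M), zero_pow (by omega), sub_zero, mul_comm]
  have h2 : ∫ v in z * (1 + s)..z * alphaTwo s z, ((s + 1) + (s - z⁻¹) * v) ≤
      (z * alphaTwo s z - z * (1 + s)) * (1 + s) := by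
    have hle : ∫ v in z * (1 + s)..z * alphaTwo s z, ((s + 1) + (s - z⁻¹) * v) ≤
        ∫ v in z * (1 + s)..z * alphaTwo s z, (1 + s) := by
      refine intervalIntegral.integral_mono_on hα.le
        ((by fun_prop : Continuous _).intervalIntegrable _ _)
        ((by fun_prop : Continuous _).intervalIntegrable _ _) fun v hv => ?_
      have hv0 : 0 ≤ v := le_trans (by positivity) hv.1
      linarith [mul_nonpos_of_nonpos_of_nonneg hq hv0]
    refine hle.trans_eq ?_
    rw [intervalIntegral.integral_const, smul_eq_mul]
  calc _ ≤ (M : ℝ) * (z * ((1 + s) * (s ^ M / M)) +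
        s ^ (M - 1) * ((z * alphaTwo s z - z * (1 + s)) * (1 + s))) := by gcongr
    _ = penultConst M s z := by
      rw [penultConst, ← pow_sub_one_mul (by omega : M ≠ 0) s]
      ring

/-! ### Asymptotics -/

lemma tendsto_exp_neg_div_atTop (K : ℝ) :
    Tendsto (fun P : ℝ => Real.exp (-(K / P))) atTop (nhds 1) := by
  have h : Tendsto (fun P : ℝ => -(K / P)) atTop (nhds (-0)) :=
    (tendsto_const_nhds.div_atTop tendsto_id).neg
  rw [neg_zero] at h
  simpa [Function.comp_def] using (Real.continuous_exp.tendsto 0).comp h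

lemma tendsto_of_exp_neg_div_bounds {f : ℝ → ℝ} {K V : ℝ}
    (hf : ∀ P : ℝ, 0 < P → Real.exp (-(K / P)) * V ≤ f P ∧ f P ≤ V) :
    Tendsto f atTop (nhds V) := by
  refine tendsto_of_tendsto_of_tendsto_of_le_of_le' (g := fun P => Real.exp (-(K / P)) * V) ?_
    tendsto_const_nhds ?_ ?_
  · simpa using (tendsto_exp_neg_div_atTop K).mul_const V
  · filter_upwards [eventually_gt_atTop 0] with P hP using (hf P hP).1
  · filter_upwards [eventually_gt_atTop 0] with P hP using (hf P hP).2

lemma isEquivalent_div_pow_of_tendsto {f : ℝ → ℝ} {V : ℝ} {N : ℕ} (hV : V ≠ 0)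
    (hf : Tendsto (fun P : ℝ => P ^ N * f P) atTop (nhds V)) :
    f ~[atTop] fun P : ℝ => V / P ^ N := by
  have hne : ∀ᶠ P : ℝ in atTop, V / P ^ N ≠ 0 := by
    filter_upwards [eventually_gt_atTop 0] with P hP
    positivity
  rw [isEquivalent_iff_tendsto_one hne]
  have h := hf.div_const V
  rw [div_self hV] at h
  refine h.congr' ?_
  filter_upwards [eventually_gt_atTop 0] with P hP
  simp only [Pi.div_apply]
  field_simp

lemma isTheta_const_div_pow {V : ℝ} (hV : V ≠ 0) (N : ℕ) :
    (fun P : ℝ => V / P ^ N) =Θ[atTop] fun P : ℝ => 1 / P ^ N := by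
  have : (fun P : ℝ => V / P ^ N) = fun P => V * (1 / P ^ N) := by
    ext P
    ring
  rw [this]
  exact (isTheta_const_mul_left hV).2 (isTheta_refl _ _)

lemma isTheta_one_div_pow_of_tendsto {f : ℝ → ℝ} {V : ℝ} {N : ℕ} (hV : V ≠ 0)
    (hf : Tendsto (fun P : ℝ => P ^ N * f P) atTop (nhds V)) :
    f =Θ[atTop] fun P : ℝ => 1 / P ^ N :=
  (isEquivalent_div_pow_of_tendsto hV hf).isTheta.trans (isTheta_const_div_pow hV N)

lemma isLittleO_one_div_pow_succ (N : ℕ) :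
    (fun P : ℝ => 1 / P ^ (N + 1)) =o[atTop] fun P : ℝ => 1 / P ^ N := by
  refine (isLittleO_iff_tendsto' ?_).2 ?_
  · filter_upwards [eventually_gt_atTop 0] with P hP h0
    exact absurd h0 (by positivity)
  · refine tendsto_inv_atTop_zero.congr' ?_
    filter_upwards [eventually_gt_atTop 0] with P hP
    rw [pow_succ]
    field_simp

/-- An error of order `1 / P ^ (N + 1)` does not affect a leading term of order `1 / P ^ N`. -/
lemma isEquivalent_const_div_pow_of_sub_isBigO {f : ℝ → ℝ} {V : ℝ} {N : ℕ} (hV : V ≠ 0)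
    (hf : (fun P : ℝ => f P - V / P ^ N) =O[atTop] fun P : ℝ => 1 / P ^ (N + 1)) :
    f ~[atTop] fun P : ℝ => V / P ^ N :=
  (hf.trans_isLittleO (isLittleO_one_div_pow_succ N)).trans_isTheta
    (isTheta_const_div_pow hV N).symm

lemma tendsto_pow_mul_div_pow (V : ℝ) (N : ℕ) :
    Tendsto (fun P : ℝ => P ^ N * (V / P ^ N)) atTop (nhds V) := by
  refine tendsto_const_nhds.congr' ?_
  filter_upwards [eventually_gt_atTop 0] with P hP
  field_simp

lemma sum_range_add_two_eq {M : ℕ} (hM : 2 ≤ M) (q : ℕ → ℝ) :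
    ∑ m ∈ Finset.range (M + 2), q m =
      ∑ m ∈ Finset.Icc 1 (M - 2), q m + q (M - 1) + q 0 + q M + q (M + 1) := by
  obtain ⟨n, rfl⟩ := Nat.exists_eq_add_of_le' hM
  have h : Finset.Icc 1 n = Finset.Ico 1 (n + 1) := by
    ext
    simp
  rw [Finset.sum_range_succ, Finset.sum_range_succ, Finset.sum_range_succ, Finset.sum_range_succ',
    Nat.add_sub_cancel, h, Finset.sum_Ico_eq_sum_range, Nat.add_sub_cancel,
    show n + 2 - 1 = n + 1 from rfl]
  simp only [add_comm 1]
  ring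

end SGF

theorem theorem2 {Ω : Type*} [MeasurableSpace Ω] (μ : Measure Ω) [IsProbabilityMeasure μ]
    (M : ℕ) (hM : 2 ≤ M)
    (g : Ω → ℂ) (h : Fin M → Ω → ℂ)
    (hg : HasLaw g SGF.stdComplexGaussian μ)
    (hh : ∀ k, HasLaw (h k) SGF.stdComplexGaussian μ)
    (hindep : iIndepFun (fun i : Option (Fin M) => i.elim g h) μ)
    (Rs R₀ : ℝ) (hRs : 0 < Rs) (hR₀ : 0 < R₀)
    (hε : SGF.eps Rs * SGF.eps R₀ < 1) :
    -- the outage probability is the sum of the `Q_m`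
    (∀ Ps P₀ : ℝ, 0 < Ps → 0 < P₀ →
      SGF.Pout μ g h Rs R₀ Ps P₀ =
        ∑ m ∈ Finset.range (M + 2), SGF.Q μ g h Rs R₀ Ps P₀ m) ∧
    -- the approximation of the outage probability for `Ps = P₀ = P → ∞`, with its error
    (fun P : ℝ => SGF.Pout μ g h Rs R₀ P P) ~[atTop]
      (fun P : ℝ => SGF.approx M (SGF.eps Rs) (SGF.eps R₀) P) ∧
    (fun P : ℝ => SGF.Pout μ g h Rs R₀ P P - SGF.approx M (SGF.eps Rs) (SGF.eps R₀) P) =O[atTop]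
      (fun P : ℝ => 1 / P ^ (M + 1)) ∧
    -- all terms of the approximation but `ε_s ^ M / P ^ M` are of order `1 / P ^ (M + 1)`
    (∀ m ∈ Finset.Icc 1 (M - 2),
      (fun P : ℝ => SGF.approxMid M (SGF.eps Rs) (SGF.eps R₀) P m) =Θ[atTop]
        (fun P : ℝ => 1 / P ^ (M + 1))) ∧
    (fun P : ℝ => SGF.approxPenult M (SGF.eps Rs) (SGF.eps R₀) P) =Θ[atTop]
      (fun P : ℝ => 1 / P ^ (M + 1)) ∧
    (fun P : ℝ => SGF.approxZero M (SGF.eps Rs) (SGF.eps R₀) P) =Θ[atTop]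
      (fun P : ℝ => 1 / P ^ (M + 1)) ∧
    (fun P : ℝ => SGF.approxFull M (SGF.eps Rs) (SGF.eps R₀) P - SGF.eps Rs ^ M / P ^ M) =Θ[atTop]
      (fun P : ℝ => 1 / P ^ (M + 1)) ∧
    (fun P : ℝ => SGF.approxLast M (SGF.eps Rs) (SGF.eps R₀) P) =Θ[atTop]
      (fun P : ℝ => 1 / P ^ (M + 1)) ∧
    -- the approximations of the individual `Q_m`
    (∀ m ∈ Finset.Icc 1 (M - 2),
      (fun P : ℝ => SGF.Q μ g h Rs R₀ P P m) ~[atTop]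
        (fun P : ℝ => SGF.approxMid M (SGF.eps Rs) (SGF.eps R₀) P m)) ∧
    (fun P : ℝ => SGF.Q μ g h Rs R₀ P P (M - 1)) =Θ[atTop]
      (fun P : ℝ => SGF.approxPenult M (SGF.eps Rs) (SGF.eps R₀) P) ∧
    (∀ P : ℝ, 0 < P →
      SGF.Q μ g h Rs R₀ P P (M - 1) ≤ SGF.approxPenult M (SGF.eps Rs) (SGF.eps R₀) P) ∧
    (fun P : ℝ => SGF.Q μ g h Rs R₀ P P 0) ~[atTop]
      (fun P : ℝ => SGF.approxZero M (SGF.eps Rs) (SGF.eps R₀) P) ∧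
    (fun P : ℝ => SGF.Q μ g h Rs R₀ P P M) ~[atTop]
      (fun P : ℝ => SGF.approxFull M (SGF.eps Rs) (SGF.eps R₀) P) ∧
    (fun P : ℝ => SGF.Q μ g h Rs R₀ P P (M + 1)) ~[atTop]
      (fun P : ℝ => SGF.approxLast M (SGF.eps Rs) (SGF.eps R₀) P) := by
  have hM1 : 1 ≤ M := by omega
  have hlaw := SGF.hasLaw_gainsSq_gainSq hg hh hindep
  have hs := SGF.eps_pos hRs
  have hz := SGF.eps_pos hR₀
  have hsum : ∀ Ps P₀ : ℝ, 0 < Ps → 0 < P₀ → SGF.Pout μ g h Rs R₀ Ps P₀ =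
      ∑ m ∈ Finset.range (M + 2), SGF.Q μ g h Rs R₀ Ps P₀ m := fun Ps P₀ hPs hP₀ =>
    SGF.Pout_eq_sum_Q hM1 hlaw hRs hR₀ hPs hP₀
  have hV : ∀ m ≤ M, SGF.limitVolume M (SGF.eps Rs) (SGF.eps R₀) m ≠ 0 := fun m hm =>
    (SGF.limitVolume_pos hm hs hz hε).ne'
  have hVlast := (SGF.integral_last_pos M hs hz).ne'
  have hpen := (SGF.penultConst_pos hM hs hz hε).ne'
  have tMid : ∀ m ∈ Finset.Icc 1 (M - 2), Tendsto
      (fun P : ℝ => P ^ (M + 1) * SGF.approxMid M (SGF.eps Rs) (SGF.eps R₀) P m) atTop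
      (nhds (SGF.limitVolume M (SGF.eps Rs) (SGF.eps R₀) m)) := by
    intro m hm
    simp only [SGF.approxMid_eq (show m ≤ M by have := Finset.mem_Icc.1 hm; omega) hs hz hε]
    exact SGF.tendsto_pow_mul_div_pow _ _
  have tPen : Tendsto
      (fun P : ℝ => P ^ (M + 1) * SGF.approxPenult M (SGF.eps Rs) (SGF.eps R₀) P) atTop
      (nhds (SGF.penultConst M (SGF.eps Rs) (SGF.eps R₀))) := by
    simp only [SGF.approxPenult_eq hM]
    exact SGF.tendsto_pow_mul_div_pow _ _
  have tZero : Tendsto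
      (fun P : ℝ => P ^ (M + 1) * SGF.approxZero M (SGF.eps Rs) (SGF.eps R₀) P) atTop
      (nhds (SGF.limitVolume M (SGF.eps Rs) (SGF.eps R₀) 0)) := by
    simp only [SGF.approxZero_eq hM hs hz hε, mul_left_comm _ (Real.exp _)]
    have h1 := SGF.tendsto_exp_neg_div_atTop (-(M : ℝ))
    simp only [neg_div, neg_neg] at h1
    simpa using h1.mul (SGF.tendsto_pow_mul_div_pow
      (SGF.limitVolume M (SGF.eps Rs) (SGF.eps R₀) 0) (M + 1))
  have tLast : Tendsto
      (fun P : ℝ => P ^ (M + 1) * SGF.approxLast M (SGF.eps Rs) (SGF.eps R₀) P) atTop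
      (nhds (∫ v in (0 : ℝ)..SGF.eps R₀, (SGF.eps Rs * (v + 1)) ^ M)) := by
    simp only [SGF.approxLast_eq]
    exact SGF.tendsto_pow_mul_div_pow _ _
  have tQ : ∀ m < M, Tendsto (fun P : ℝ => P ^ (M + 1) * SGF.Q μ g h Rs R₀ P P m) atTop
      (nhds (SGF.limitVolume M (SGF.eps Rs) (SGF.eps R₀) m)) := fun m hm =>
    SGF.tendsto_of_exp_neg_div_bounds fun P hP =>
      SGF.Q_bounds_of_lt hM1 hlaw hRs hR₀ hε hP hm
  have tQLast : Tendsto (fun P : ℝ => P ^ (M + 1) * SGF.Q μ g h Rs R₀ P P (M + 1)) atTop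
      (nhds (∫ v in (0 : ℝ)..SGF.eps R₀, (SGF.eps Rs * (v + 1)) ^ M)) :=
    SGF.tendsto_of_exp_neg_div_bounds fun P hP => SGF.Q_last_bounds hM1 hlaw hRs hR₀ hP
  have eqv : ∀ {f₁ f₂ : ℝ → ℝ} {V : ℝ}, V ≠ 0 →
      Tendsto (fun P : ℝ => P ^ (M + 1) * f₁ P) atTop (nhds V) →
      Tendsto (fun P : ℝ => P ^ (M + 1) * f₂ P) atTop (nhds V) → f₁ ~[atTop] f₂ :=
    fun hV h₁ h₂ => (SGF.isEquivalent_div_pow_of_tendsto hV h₁).trans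
      (SGF.isEquivalent_div_pow_of_tendsto hV h₂).symm
  have theta : ∀ {f : ℝ → ℝ} {V : ℝ}, V ≠ 0 →
      Tendsto (fun P : ℝ => P ^ (M + 1) * f P) atTop (nhds V) →
      f =Θ[atTop] fun P : ℝ => 1 / P ^ (M + 1) :=
    fun hV h => SGF.isTheta_one_div_pow_of_tendsto hV h
  have thFull : (fun P : ℝ => SGF.approxFull M (SGF.eps Rs) (SGF.eps R₀) P -
      SGF.eps Rs ^ M / P ^ M) =Θ[atTop] (fun P : ℝ => 1 / P ^ (M + 1)) := by
    simp only [SGF.approxFull_sub M hz]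
    exact SGF.isTheta_const_div_pow (by positivity) _
  have hsM : SGF.eps Rs ^ M ≠ 0 := by positivity
  -- `1 - exp (-K / P) ≤ K / P` bounds the relative deviation of `Q_M` from its leading term
  have oQFull : (fun P : ℝ => SGF.Q μ g h Rs R₀ P P M - SGF.eps Rs ^ M / P ^ M) =O[atTop]
      (fun P : ℝ => 1 / P ^ (M + 1)) := by
    set K := SGF.eps R₀ * (1 + SGF.eps Rs) + M * SGF.eps Rs
    refine IsBigO.of_bound (K * SGF.eps Rs ^ M) ?_
    filter_upwards [eventually_gt_atTop 0] with P hP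
    obtain ⟨h1, h2⟩ := SGF.Q_full_bounds hM1 hlaw hRs hR₀ hP
    have h3 := mul_le_mul_of_nonneg_right (Real.add_one_le_exp (-(K / P)))
      (show 0 ≤ SGF.eps Rs ^ M / P ^ M by positivity)
    rw [Real.norm_of_nonpos (sub_nonpos.2 h2), Real.norm_of_nonneg (by positivity)]
    have h4 : K * SGF.eps Rs ^ M * (1 / P ^ (M + 1)) = K / P * (SGF.eps Rs ^ M / P ^ M) := by
      rw [pow_succ]
      field_simp
    rw [h4]
    linarith
  have oErr : (fun P : ℝ => SGF.Pout μ g h Rs R₀ P P -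
      SGF.approx M (SGF.eps Rs) (SGF.eps R₀) P) =O[atTop] (fun P : ℝ => 1 / P ^ (M + 1)) := by
    have hmid : (fun P : ℝ => ∑ m ∈ Finset.Icc 1 (M - 2), (SGF.Q μ g h Rs R₀ P P m -
        SGF.approxMid M (SGF.eps Rs) (SGF.eps R₀) P m)) =O[atTop]
        (fun P : ℝ => 1 / P ^ (M + 1)) := by
      refine IsBigO.fun_sum fun m hm => ?_
      have hm' : m < M := by have := Finset.mem_Icc.1 hm; omega
      exact (theta (hV m hm'.le) (tQ m hm')).isBigO.sub (theta (hV m hm'.le) (tMid m hm)).isBigO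
    refine IsBigO.congr' ((((hmid.add
      ((theta (hV (M - 1) (by omega)) (tQ (M - 1) (by omega))).isBigO.sub
        (theta hpen tPen).isBigO)).add
      ((theta (hV 0 (by omega)) (tQ 0 (by omega))).isBigO.sub
        (theta (hV 0 (by omega)) tZero).isBigO)).add (oQFull.sub thFull.isBigO)).add
      ((theta hVlast tQLast).isBigO.sub (theta hVlast tLast).isBigO)) ?_ EventuallyEq.rfl
    filter_upwards [eventually_gt_atTop 0] with P hP
    rw [hsum P P hP hP, SGF.sum_range_add_two_eq hM, SGF.approx, Finset.sum_sub_distrib]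
    ring
  have leadFull : (fun P : ℝ => SGF.approxFull M (SGF.eps Rs) (SGF.eps R₀) P) ~[atTop]
      (fun P : ℝ => SGF.eps Rs ^ M / P ^ M) :=
    SGF.isEquivalent_const_div_pow_of_sub_isBigO hsM thFull.isBigO
  have oApprox : (fun P : ℝ => SGF.approx M (SGF.eps Rs) (SGF.eps R₀) P -
      SGF.eps Rs ^ M / P ^ M) =O[atTop] (fun P : ℝ => 1 / P ^ (M + 1)) := by
    have hmid : (fun P : ℝ => ∑ m ∈ Finset.Icc 1 (M - 2),
        SGF.approxMid M (SGF.eps Rs) (SGF.eps R₀) P m) =O[atTop]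
        (fun P : ℝ => 1 / P ^ (M + 1)) := by
      refine IsBigO.fun_sum fun m hm => ?_
      have hm' : m < M := by have := Finset.mem_Icc.1 hm; omega
      exact (theta (hV m hm'.le) (tMid m hm)).isBigO
    refine IsBigO.congr_left ((((hmid.add (theta hpen tPen).isBigO).add
      (theta (hV 0 (by omega)) tZero).isBigO).add thFull.isBigO).add
      (theta hVlast tLast).isBigO) fun P => ?_
    rw [SGF.approx]
    ring
  have leadApprox := SGF.isEquivalent_const_div_pow_of_sub_isBigO hsM oApprox
  have leadPout : (fun P : ℝ => SGF.Pout μ g h Rs R₀ P P) ~[atTop]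
      (fun P : ℝ => SGF.eps Rs ^ M / P ^ M) :=
    SGF.isEquivalent_const_div_pow_of_sub_isBigO hsM
      ((oErr.add oApprox).congr_left fun P => by ring)
  refine ⟨hsum, leadPout.trans leadApprox.symm, oErr, ?_, theta hpen tPen,
    theta (hV 0 (by omega)) tZero, thFull, theta hVlast tLast, ?_, ?_, ?_, ?_,
    (SGF.isEquivalent_const_div_pow_of_sub_isBigO hsM oQFull).trans leadFull.symm,
    eqv hVlast tQLast tLast⟩
  · intro m hm
    exact theta (hV m (by have := Finset.mem_Icc.1 hm; omega)) (tMid m hm)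
  · intro m hm
    have hm' : m < M := by have := Finset.mem_Icc.1 hm; omega
    exact eqv (hV m hm'.le) (tQ m hm') (tMid m hm)
  · exact (theta (hV (M - 1) (by omega)) (tQ (M - 1) (by omega))).trans (theta hpen tPen).symm
  · intro P hP
    rw [SGF.approxPenult_eq hM, le_div_iff₀' (by positivity)]
    exact (SGF.Q_bounds_of_lt hM1 hlaw hRs hR₀ hε hP (by omega : M - 1 < M)).2.trans
      (SGF.limitVolume_penult_le hM hs hz hε)
  · exact eqv (hV 0 (by omega)) (tQ 0 (by omega)) tZero
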